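/- **Setting.** Let $G$ be an undirected simple graph on $\{1,\dots,n\}$ with maximum degree $d$. Let $F$ be its oriented incidence matrix: the row of the edge $(i,j)$, $i<j$, has $-1$ in column $i$, $+1$ in column $j$ and $0$ elsewhere. The graph difference operators are $\Delta^{(1)}=F$ and $\Delta^{(k+1)}=F^T\Delta^{(k)}$ for odd $k$, $\Delta^{(k+1)}=F\Delta^{(k)}$ for even $k\ge 2$. Fix an integer $k\ge 0$. Consider the linear model $y=X\beta^*+\varepsilon$ with $X\in\mathbb{R}^{N\times n}$, where $\|\Delta^{(k+1)}\beta^*\|_0\le s_1$ and $\|\beta^*\|_0\le s_2$ with integers $s_1,s_2\ge 1$, and let $$\hat\beta\in\operatorname*{argmin}_{\beta\in\mathbb{R}^n}\ \frac{1}{2N}\|y-X\beta\|_2^2+\lambda_g\|\Delta^{(k+1)}\beta\|_1+\lambda\|\beta\|_1 .$$ A real random variable $Z$ is $\sigma$-sub-Gaussian if $\mathbb{E}Z=0$ and $\mathbb{E}e^{tZ}\le e^{\sigma^2t^2/2}$ for all $t\in\mathbb{R}$; a random vector $Z$ is $\sigma$-sub-Gaussian if $\mathbb{E}Z=0$ and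 $u^TZ$ is $\sigma$-sub-Gaussian for every unit vector $u$. **Assumptions.** Let $\sigma_x,c,c'>0$ and $0\le\nu<1$ be constants. The rows of $X$ are i.i.d. draws from a $\sigma_x$-sub-Gaussian distribution with covariance matrix $\Sigma_x$, all of whose eigenvalues lie in $[c,c']$. The components of $\varepsilon$ are i.i.d. draws from a $\sigma_\varepsilon$-sub-Gaussian distribution, $\sigma_\varepsilon>0$, and $\varepsilon$ is independent of $X$. Moreover $s_2/s_1\ge\nu$. **Theorem.** There are constants $c_0,C_0>0$, depending only on $k,\sigma_x,c,c',\nu$, with the following property. Let $c_1$ be any constant, and consider any sequence of such models (in which $N,n,s_1,s_2,\sigma_\varepsilon$, the graph, $\beta^*$ and the distributions may all vary) with $N\to\infty$, $n\ge 2$, $N\ge C_0\,s_2\log n$, and with tuning parameters $$c_0\,\sigma_\varepsilon\sqrt{\frac{\log n}{N}}\le\lambda\le c_1\,\sigma_\varepsilon\sqrt{\frac{\log n}{N}},\qquad \lambda_g=\lambda\sqrt{\frac{\nu}{(2d)^{k+1}}}$$ (for a graph without edges the penalty $\|\Delta^{(k+1)}\beta\|_1$ vanishes and the value of $\lambda_g$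 is irrelevant). Then $$\|\hat\beta-\beta^*\|_2=\mathcal{O}_{\mathbb P}\!\left(\sigma_\varepsilon\sqrt{\frac{s_2\log n}{N}}\right),\qquad \|\hat\beta-\beta^*\|_1=\mathcal{O}_{\mathbb P}\!\left(\sigma_\varepsilon s_2\sqrt{\frac{\log n}{N}}\right),$$ $$\frac1N\|X(\hat\beta-\beta^*)\|_2^2=\mathcal{O}_{\mathbb P}\!\left(\sigma_\varepsilon^2\,\frac{s_2\log n}{N}\right).$$ Here $Y=\mathcal{O}_{\mathbb P}(a)$ along the sequence means: for every $\delta>0$ there is $M>0$ such that $\mathbb{P}(|Y|>Ma)\le\delta$ for all sufficiently late members of the sequence. -/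

import Mathlib

open MeasureTheory ProbabilityTheory Filter
open scoped Matrix Topology

noncomputable section

namespace GraphLasso

/-- The `ℓ₁`-norm of a finitely indexed real vector. -/
def l1Norm {ι : Type*} [Fintype ι] (v : ι → ℝ) : ℝ := ∑ i, |v i|

/-- The `ℓ₂`-norm of a finitely indexed real vector. -/
def l2Norm {ι : Type*} [Fintype ι] (v : ι → ℝ) : ℝ := Real.sqrt (∑ i, v i ^ 2)

section Graph

variable {n : ℕ} (G : SimpleGraph (Fin n))

/-- The edges of `G`, each one written as the pair `(i, j)` with `i < j`. -/
abbrev OrientedEdge : Type := {e : Fin n × Fin n // e.1 < e.2 ∧ G.Adj e.1 e.2}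

open Classical in
instance : Fintype (OrientedEdge G) := Subtype.fintype _

/-- The oriented incidence matrix `F`: the row of the edge `(i, j)`, `i < j`, has `-1` in column
`i`, `+1` in column `j`, and `0` elsewhere. -/
def orientedIncidence : Matrix (OrientedEdge G) (Fin n) ℝ :=
  Matrix.of fun e v => if v = e.1.1 then -1 else if v = e.1.2 then 1 else 0

/-- The index type of the rows of `Δ^(k+1)`: edges for even `k`, nodes for odd `k`. -/
def DiffRow : ℕ → Type
  | 0 => OrientedEdge G
  | 1 => Fin n
  | k + 2 => DiffRow k

instance instFintypeDiffRow : ∀ k : ℕ, Fintype (DiffRow G k)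
  | 0 => inferInstanceAs (Fintype (OrientedEdge G))
  | 1 => inferInstanceAs (Fintype (Fin n))
  | k + 2 => instFintypeDiffRow k

/-- The matrix that turns `Δ^(k+1)` into `Δ^(k+2)`: it is `Fᵀ` for even `k` and `F` for odd `k`. -/
def diffStep : ∀ k : ℕ, Matrix (DiffRow G (k + 1)) (DiffRow G k) ℝ
  | 0 => (orientedIncidence G)ᵀ
  | 1 => orientedIncidence G
  | k + 2 => diffStep k

/-- `graphDiff G k` is the graph difference operator `Δ^(k+1)`: `Δ^(1) = F`, and successive
operators arise by multiplying from the left by `Fᵀ` and by `F` alternately. -/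
def graphDiff : ∀ k : ℕ, Matrix (DiffRow G k) (Fin n) ℝ
  | 0 => orientedIncidence G
  | k + 1 => diffStep G k * graphDiff k

open Classical in
/-- The maximum degree of `G`. -/
def maxDeg : ℕ := G.maxDegree

/-- The class of vectors `β` with at most `s₁` non-zero entries of `Δ^(k+1) β` and at most `s₂`
non-zero entries of `β`. -/
def sparseClass (k s₁ s₂ : ℕ) : Set (Fin n → ℝ) :=
  {β | hammingNorm (graphDiff G k *ᵥ β) ≤ s₁ ∧ hammingNorm β ≤ s₂}

/-- The objective function of the `k`-th order Graph-Piecewise-Polynomial-Lasso. -/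
def objective (k : ℕ) {N : ℕ} (X : Matrix (Fin N) (Fin n) ℝ) (y : Fin N → ℝ) (lamg lam : ℝ)
    (β : Fin n → ℝ) : ℝ :=
  1 / (2 * (N : ℝ)) * l2Norm (y - X *ᵥ β) ^ 2
    + lamg * l1Norm (graphDiff G k *ᵥ β) + lam * l1Norm β

/-- `b` is a `k`-th order Graph-Piecewise-Polynomial-Lasso estimate for the data `X`, `y`. -/
def IsEstimate (k : ℕ) {N : ℕ} (X : Matrix (Fin N) (Fin n) ℝ) (y : Fin N → ℝ) (lamg lam : ℝ)
    (b : Fin n → ℝ) : Prop :=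
  IsMinOn (objective G k X y lamg lam) Set.univ b

end Graph

section Probability

variable {Ω : Type*} [MeasurableSpace Ω]

/-- A real random variable is `σ`-sub-Gaussian: mean zero, and `E exp (t Z) ≤ exp (σ² t² / 2)` for
all real `t` (the expectation being finite). -/
structure IsSubGaussian (σ : ℝ) (Z : Ω → ℝ) (P : Measure Ω) : Prop where
  mean_zero : ∫ ω, Z ω ∂P = 0
  integrable_exp : ∀ t : ℝ, Integrable (fun ω => Real.exp (t * Z ω)) P
  mgf_le : ∀ t : ℝ, ∫ ω, Real.exp (t * Z ω) ∂P ≤ Real.exp (σ ^ 2 * t ^ 2 / 2)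

/-- A random vector is `σ`-sub-Gaussian: mean zero, and `uᵀ Z` is `σ`-sub-Gaussian for every unit
vector `u`. -/
structure IsSubGaussianVec {n : ℕ} (σ : ℝ) (Z : Ω → Fin n → ℝ) (P : Measure Ω) : Prop where
  mean_zero : ∀ i, ∫ ω, Z ω i ∂P = 0
  dot : ∀ u : Fin n → ℝ, l2Norm u = 1 → IsSubGaussian σ (fun ω => u ⬝ᵥ Z ω) P

/-- `X` is a row-wise `(σ, S)`-sub-Gaussian random matrix: its rows are i.i.d. draws from a
`σ`-sub-Gaussian distribution with covariance matrix `S`. -/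
structure IsRowwiseSubGaussian {N n : ℕ} (σ : ℝ) (S : Matrix (Fin n) (Fin n) ℝ)
    (X : Ω → Matrix (Fin N) (Fin n) ℝ) (P : Measure Ω) : Prop where
  measurable : ∀ i j, Measurable fun ω => X ω i j
  indep : iIndepFun (fun (i : Fin N) (ω : Ω) => (X ω i : Fin n → ℝ)) P
  ident : ∀ i i' : Fin N,
    IdentDistrib (fun ω => (X ω i : Fin n → ℝ)) (fun ω => (X ω i' : Fin n → ℝ)) P P
  subGaussian : ∀ i, IsSubGaussianVec σ (fun ω => (X ω i : Fin n → ℝ)) P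
  covariance : ∀ i a b, cov[fun ω => X ω i a, fun ω => X ω i b; P] = S a b

/-- The components of the noise vector are i.i.d. draws from a `σ`-sub-Gaussian distribution. -/
structure IsSubGaussianNoise {N : ℕ} (σ : ℝ) (ε : Ω → Fin N → ℝ) (P : Measure Ω) : Prop where
  measurable : ∀ i, Measurable fun ω => ε ω i
  indep : iIndepFun (fun (i : Fin N) (ω : Ω) => ε ω i) P
  ident : ∀ i i' : Fin N, IdentDistrib (fun ω => ε ω i) (fun ω => ε ω i') P P
  subGaussian : ∀ i, IsSubGaussian σ (fun ω => ε ω i) P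

end Probability

/-- `Y_j = O_P(a_j)` as `j → ∞`, where `Y_j` lives on its own probability space `(Ω_j, P_j)`:
for every `δ > 0` there is `M > 0` such that `P_j (|Y_j| > M a_j) ≤ δ` for all large `j`. -/
def IsBigOP {Ω : ℕ → Type*} [∀ j, MeasurableSpace (Ω j)] (P : ∀ j, Measure (Ω j))
    (Y : ∀ j, Ω j → ℝ) (a : ℕ → ℝ) : Prop :=
  ∀ δ : ℝ, 0 < δ → ∃ M : ℝ, 0 < M ∧
    ∀ᶠ j in atTop, P j {ω | M * a j < |Y j ω|} ≤ ENNReal.ofReal δ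

end GraphLasso

end

/-!
The operators satisfy `‖Δ^(k+1) v‖₂² ≤ (2d)^(k+1) ‖v‖₂²`, so the choice of `λ_g` makes the graph
penalty cost no more than the `ℓ₁` penalty, and the error of the estimate obeys the basic inequality
of the ordinary Lasso with a larger constant. A restricted eigenvalue condition then gives the
rates. It is proved by Maurey's empirical method: a lower bound for the Gram form on sums of `m`
signed unit vectors (a union bound with Chernoff tails) extends, up to a loss of order `1 / m`, to
all effectively sparse vectors.
-/

noncomputable section

namespace GraphLasso

section Norms

variable {ι κ : Type*} [Fintype ι] [Fintype κ]

lemma l1Norm_nonneg (v : ι → ℝ) : 0 ≤ l1Norm v :=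
  Finset.sum_nonneg fun _ _ => abs_nonneg _

lemma l2Norm_nonneg (v : ι → ℝ) : 0 ≤ l2Norm v := Real.sqrt_nonneg _

lemma l2Norm_sq (v : ι → ℝ) : l2Norm v ^ 2 = ∑ i, v i ^ 2 :=
  Real.sq_sqrt (Finset.sum_nonneg fun _ _ => sq_nonneg _)

lemma l2Norm_sq_eq_dotProduct (v : ι → ℝ) : l2Norm v ^ 2 = v ⬝ᵥ v := by
  rw [l2Norm_sq]
  simp only [dotProduct, sq]

lemma l2Norm_smul (t : ℝ) (v : ι → ℝ) : l2Norm (t • v) = |t| * l2Norm v := by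
  simp only [l2Norm, Pi.smul_apply, smul_eq_mul, mul_pow, ← Finset.mul_sum]
  rw [Real.sqrt_mul (sq_nonneg t), Real.sqrt_sq_eq_abs]

lemma l2Norm_sub_sq (u v : ι → ℝ) :
    l2Norm (u - v) ^ 2 = l2Norm u ^ 2 - 2 * (u ⬝ᵥ v) + l2Norm v ^ 2 := by
  simp only [l2Norm_sq_eq_dotProduct, sub_dotProduct, dotProduct_sub]
  rw [dotProduct_comm v u]
  ring

lemma dotProduct_le_l2Norm_mul_l2Norm (u v : ι → ℝ) : u ⬝ᵥ v ≤ l2Norm u * l2Norm v :=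
  Real.sum_mul_le_sqrt_mul_sqrt _ _ _

lemma dotProduct_le_mul_l1Norm {u : ι → ℝ} {η : ℝ} (hu : ∀ i, |u i| ≤ η) (v : ι → ℝ) :
    u ⬝ᵥ v ≤ η * l1Norm v := by
  rw [dotProduct, l1Norm, Finset.mul_sum]
  refine Finset.sum_le_sum fun i _ => (le_abs_self _).trans ?_
  rw [abs_mul]
  exact mul_le_mul_of_nonneg_right (hu i) (abs_nonneg _)

lemma sum_abs_le_sqrt_card_mul_l2Norm (s : Finset ι) (v : ι → ℝ) :
    ∑ i ∈ s, |v i| ≤ √s.card * l2Norm v := by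
  calc ∑ i ∈ s, |v i| ≤ √s.card * √(∑ i ∈ s, v i ^ 2) := by
        simpa using Real.sum_mul_le_sqrt_mul_sqrt s 1 fun i => |v i|
    _ ≤ √s.card * l2Norm v := by
        refine mul_le_mul_of_nonneg_left (Real.sqrt_le_sqrt ?_) (Real.sqrt_nonneg _)
        exact Finset.sum_le_univ_sum_of_nonneg fun i => sq_nonneg (v i)

lemma l1Norm_le_sqrt_card_mul_l2Norm (v : ι → ℝ) :
    l1Norm v ≤ √(Fintype.card ι) * l2Norm v :=
  sum_abs_le_sqrt_card_mul_l2Norm Finset.univ v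

lemma l1Norm_sub_l1Norm_add_le {a : ι → ℝ} {s : ℕ} (ha : hammingNorm a ≤ s) (e : ι → ℝ) :
    l1Norm a - l1Norm (a + e) ≤ 2 * (√s * l2Norm e) - l1Norm e := by
  have coord : ∀ i, |a i| - |a i + e i| ≤ 2 * (if a i ≠ 0 then |e i| else 0) - |e i| := by
    intro i
    by_cases hi : a i = 0
    · simp [hi]
    · have h := abs_sub_abs_le_abs_sub (a i) (a i + e i)
      rw [sub_add_cancel_left, abs_neg] at h
      rw [if_pos hi]
      linarith
  have hsupp : ∑ i with a i ≠ 0, |e i| ≤ √s * l2Norm e := by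
    have := l2Norm_nonneg e
    refine (sum_abs_le_sqrt_card_mul_l2Norm _ e).trans ?_
    gcongr
    exact ha
  calc l1Norm a - l1Norm (a + e)
      = ∑ i, (|a i| - |a i + e i|) := (Finset.sum_sub_distrib _ _).symm
    _ ≤ ∑ i, (2 * (if a i ≠ 0 then |e i| else 0) - |e i|) :=
        Finset.sum_le_sum fun i _ => coord i
    _ = 2 * ∑ i with a i ≠ 0, |e i| - l1Norm e := by
        rw [Finset.sum_sub_distrib, ← Finset.mul_sum, Finset.sum_filter, l1Norm]
    _ ≤ 2 * (√s * l2Norm e) - l1Norm e := by gcongr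

lemma l2Norm_transpose_mulVec_sq_le {A : Matrix ι κ ℝ} {C : ℝ} (hC : 0 ≤ C)
    (hA : ∀ w, l2Norm (A *ᵥ w) ^ 2 ≤ C * l2Norm w ^ 2) (z : ι → ℝ) :
    l2Norm (Aᵀ *ᵥ z) ^ 2 ≤ C * l2Norm z ^ 2 := by
  rcases (l2Norm_nonneg (Aᵀ *ᵥ z)).eq_or_lt' with h | h
  · rw [h, zero_pow two_ne_zero]
    positivity
  have hcs : l2Norm (Aᵀ *ᵥ z) ^ 2 ≤ l2Norm z * l2Norm (A *ᵥ (Aᵀ *ᵥ z)) := by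
    rw [l2Norm_sq_eq_dotProduct, Matrix.mulVec_transpose, ← Matrix.dotProduct_mulVec]
    exact dotProduct_le_l2Norm_mul_l2Norm _ _
  refine le_of_mul_le_mul_right ?_ (pow_pos h 2)
  calc l2Norm (Aᵀ *ᵥ z) ^ 2 * l2Norm (Aᵀ *ᵥ z) ^ 2
      ≤ (l2Norm z * l2Norm (A *ᵥ (Aᵀ *ᵥ z))) ^ 2 := by
        rw [← sq]
        gcongr
    _ ≤ l2Norm z ^ 2 * (C * l2Norm (Aᵀ *ᵥ z) ^ 2) := by
        rw [mul_pow]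
        gcongr
        exact hA _
    _ = C * l2Norm z ^ 2 * l2Norm (Aᵀ *ᵥ z) ^ 2 := by ring

end Norms

section GraphDifference

variable {n : ℕ} (G : SimpleGraph (Fin n))

lemma orientedIncidence_mulVec_apply (w : Fin n → ℝ) (e : OrientedEdge G) :
    (orientedIncidence G *ᵥ w) e = w e.1.2 - w e.1.1 := by
  have hne : e.1.2 ≠ e.1.1 := e.2.1.ne'
  have row : orientedIncidence G e = Pi.single e.1.2 1 - Pi.single e.1.1 1 := by
    ext v
    by_cases h1 : v = e.1.1 <;> by_cases h2 : v = e.1.2 <;>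
      simp_all [orientedIncidence]
  rw [Matrix.mulVec, row, sub_dotProduct, single_one_dotProduct, single_one_dotProduct]

open Classical in
lemma sum_orientedEdge_add (f : Fin n → ℝ) :
    ∑ e : OrientedEdge G, (f e.1.1 + f e.1.2) = ∑ v, G.degree v * f v := by
  have split (a b : Fin n) : (if G.Adj a b then f a else 0)
      = (if a < b ∧ G.Adj a b then f a else 0) + (if b < a ∧ G.Adj b a then f a else 0) := by
    rcases lt_trichotomy a b with h | rfl | h
    · simp [h, h.not_gt]
    · simp
    · simp [h, h.not_gt, G.adj_comm]
  have edges (g : Fin n × Fin n → ℝ) :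
      ∑ e : OrientedEdge G, g e.1 = ∑ a, ∑ b, if a < b ∧ G.Adj a b then g (a, b) else 0 := by
    rw [← Fintype.sum_prod_type' fun a b => if a < b ∧ G.Adj a b then g (a, b) else 0,
      ← Finset.sum_filter]
    exact (Finset.sum_subtype _ (by simp) g).symm
  have degree (a : Fin n) : G.degree a * f a = ∑ b, if G.Adj a b then f a else 0 := by
    rw [← Finset.sum_filter, Finset.sum_const, nsmul_eq_mul, ← SimpleGraph.neighborFinset_eq_filter,
      SimpleGraph.card_neighborFinset_eq_degree]
  simp only [Finset.sum_add_distrib, degree, split]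
  rw [edges fun e => f e.1, edges fun e => f e.2]
  congr 1
  exact Finset.sum_comm

lemma l2Norm_orientedIncidence_mulVec_sq_le (w : Fin n → ℝ) :
    l2Norm (orientedIncidence G *ᵥ w) ^ 2 ≤ 2 * maxDeg G * l2Norm w ^ 2 := by
  classical
  calc l2Norm (orientedIncidence G *ᵥ w) ^ 2
      = ∑ e : OrientedEdge G, (w e.1.2 - w e.1.1) ^ 2 := by
        simp only [l2Norm_sq, orientedIncidence_mulVec_apply]
    _ ≤ ∑ e : OrientedEdge G, 2 * (w e.1.1 ^ 2 + w e.1.2 ^ 2) :=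
        Finset.sum_le_sum fun e _ => by linarith [sq_nonneg (w e.1.1 + w e.1.2)]
    _ = 2 * ∑ v, G.degree v * w v ^ 2 := by
        rw [← Finset.mul_sum, sum_orientedEdge_add G fun v => w v ^ 2]
    _ ≤ 2 * ∑ v, maxDeg G * w v ^ 2 := by
        gcongr with v
        exact G.degree_le_maxDegree v
    _ = 2 * maxDeg G * l2Norm w ^ 2 := by
        rw [← Finset.mul_sum, l2Norm_sq, mul_assoc]

lemma l2Norm_diffStep_mulVec_sq_le : ∀ (k : ℕ) (w : DiffRow G k → ℝ),
    l2Norm (diffStep G k *ᵥ w) ^ 2 ≤ 2 * maxDeg G * l2Norm w ^ 2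
  | 0, w => l2Norm_transpose_mulVec_sq_le (A := orientedIncidence G) (by positivity)
      (l2Norm_orientedIncidence_mulVec_sq_le G) w
  | 1, w => l2Norm_orientedIncidence_mulVec_sq_le G w
  | k + 2, w => l2Norm_diffStep_mulVec_sq_le k w

lemma l2Norm_graphDiff_mulVec_sq_le (k : ℕ) (v : Fin n → ℝ) :
    l2Norm (graphDiff G k *ᵥ v) ^ 2 ≤ (2 * maxDeg G) ^ (k + 1) * l2Norm v ^ 2 := by
  induction k with
  | zero =>
    rw [zero_add, pow_one]
    exact l2Norm_orientedIncidence_mulVec_sq_le G v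
  | succ k ih =>
    have step : graphDiff G (k + 1) *ᵥ v = diffStep G k *ᵥ (graphDiff G k *ᵥ v) :=
      (Matrix.mulVec_mulVec ..).symm
    calc l2Norm (graphDiff G (k + 1) *ᵥ v) ^ 2
        ≤ 2 * maxDeg G * l2Norm (graphDiff G k *ᵥ v) ^ 2 :=
          step ▸ l2Norm_diffStep_mulVec_sq_le G k _
      _ ≤ 2 * maxDeg G * ((2 * maxDeg G) ^ (k + 1) * l2Norm v ^ 2) := by gcongr
      _ = (2 * maxDeg G) ^ (k + 1 + 1) * l2Norm v ^ 2 := by ring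

lemma mul_sqrt_mul_l2Norm_graphDiff_le {k s₁ s₂ : ℕ} {lam lamg : ℝ} (hlam : 0 ≤ lam)
    (hlamg : lamg ^ 2 * ((2 * maxDeg G) ^ (k + 1) * s₁) ≤ lam ^ 2 * s₂) (v : Fin n → ℝ) :
    lamg * (√s₁ * l2Norm (graphDiff G k *ᵥ v)) ≤ lam * (√s₂ * l2Norm v) := by
  have hv := l2Norm_nonneg v
  refine le_of_sq_le_sq ?_ (by positivity)
  calc (lamg * (√s₁ * l2Norm (graphDiff G k *ᵥ v))) ^ 2
      = lamg ^ 2 * s₁ * l2Norm (graphDiff G k *ᵥ v) ^ 2 := by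
        rw [mul_pow, mul_pow, Real.sq_sqrt (Nat.cast_nonneg _), mul_assoc]
    _ ≤ lamg ^ 2 * s₁ * ((2 * maxDeg G) ^ (k + 1) * l2Norm v ^ 2) := by
        gcongr
        exact l2Norm_graphDiff_mulVec_sq_le G k v
    _ = lamg ^ 2 * ((2 * maxDeg G) ^ (k + 1) * s₁) * l2Norm v ^ 2 := by ring
    _ ≤ lam ^ 2 * s₂ * l2Norm v ^ 2 := by gcongr
    _ = (lam * (√s₂ * l2Norm v)) ^ 2 := by
        rw [mul_pow, mul_pow, Real.sq_sqrt (Nat.cast_nonneg _), mul_assoc]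

lemma tuning_sq_mul_le {D ν lam s₁ s₂ : ℝ} (hD : 0 ≤ D) (hν : 0 ≤ ν) (hs₁ : 0 ≤ s₁)
    (hs₂ : 0 ≤ s₂) (h : ν ≤ s₂ / s₁) : (lam * √(ν / D)) ^ 2 * (D * s₁) ≤ lam ^ 2 * s₂ := by
  calc (lam * √(ν / D)) ^ 2 * (D * s₁) = lam ^ 2 * (ν * (D / D) * s₁) := by
        rw [mul_pow, Real.sq_sqrt (by positivity)]
        ring
    _ ≤ lam ^ 2 * (ν * 1 * s₁) := by
        gcongr
        exact div_self_le_one D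
    _ ≤ lam ^ 2 * s₂ := by
        rw [mul_one]
        gcongr
        exact mul_le_of_le_div₀ hs₂ hs₁ h

end GraphDifference

section BasicInequality

variable {N n : ℕ} {X : Matrix (Fin N) (Fin n) ℝ} {E : Fin N → ℝ} {e : Fin n → ℝ}
  {lam η κ R τ B : ℝ} {s : ℕ}

/-- The basic inequality for the error `e` of a penalized least squares estimate with design `X`
and noise `E`. It is all that is used of the estimate, and the graph enters it only through the
constant: without the graph penalty, `2 * lam` would take the place of `4 * lam`. -/
def SatisfiesBasicInequality (X : Matrix (Fin N) (Fin n) ℝ) (E : Fin N → ℝ) (lam : ℝ) (s : ℕ)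
    (e : Fin n → ℝ) : Prop :=
  1 / (2 * (N : ℝ)) * l2Norm (X *ᵥ e) ^ 2
    ≤ 1 / (N : ℝ) * (E ⬝ᵥ X *ᵥ e) + 4 * lam * (√s * l2Norm e) - lam * l1Norm e

lemma IsEstimate.satisfiesBasicInequality {G : SimpleGraph (Fin n)} {k s₁ s₂ : ℕ} {lamg : ℝ}
    {b bh : Fin n → ℝ} (hmin : IsEstimate G k X (X *ᵥ b + E) lamg lam bh) (hlam : 0 ≤ lam)
    (hlamg : 0 ≤ lamg) (htuning : lamg ^ 2 * ((2 * maxDeg G) ^ (k + 1) * s₁) ≤ lam ^ 2 * s₂)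
    (hb : b ∈ sparseClass G k s₁ s₂) : SatisfiesBasicInequality X E lam s₂ (bh - b) := by
  obtain ⟨e, rfl⟩ : ∃ e, bh = b + e := ⟨bh - b, by simp⟩
  have hobj : objective G k X (X *ᵥ b + E) lamg lam (b + e)
      ≤ objective G k X (X *ᵥ b + E) lamg lam b := hmin (Set.mem_univ b)
  have residual : X *ᵥ b + E - X *ᵥ (b + e) = E - X *ᵥ e := by
    rw [Matrix.mulVec_add]
    abel
  have penalty : lam * (l1Norm b - l1Norm (b + e))
      ≤ lam * (2 * (√s₂ * l2Norm e) - l1Norm e) :=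
    mul_le_mul_of_nonneg_left (l1Norm_sub_l1Norm_add_le hb.2 e) hlam
  have graphPenalty : lamg * (l1Norm (graphDiff G k *ᵥ b)
      - l1Norm (graphDiff G k *ᵥ b + graphDiff G k *ᵥ e))
      ≤ lamg * (2 * (√s₁ * l2Norm (graphDiff G k *ᵥ e))) := by
    refine mul_le_mul_of_nonneg_left ((l1Norm_sub_l1Norm_add_le hb.1 _).trans ?_) hlamg
    exact sub_le_self _ (l1Norm_nonneg _)
  have comparison := mul_sqrt_mul_l2Norm_graphDiff_le G hlam htuning e
  rw [objective, objective, residual, l2Norm_sub_sq, add_sub_cancel_left, Matrix.mulVec_add] at hobj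
  rw [add_sub_cancel_left, SatisfiesBasicInequality]
  have cross : 1 / (2 * (N : ℝ)) * (2 * (E ⬝ᵥ X *ᵥ e)) = 1 / (N : ℝ) * (E ⬝ᵥ X *ᵥ e) := by ring
  linarith

lemma SatisfiesBasicInequality.le_of_noise_le (h : SatisfiesBasicInequality X E lam s e)
    (hη : 0 ≤ η) (hnoise : ∀ a, |(E ᵥ* X) a| ≤ N * η) :
    1 / (N : ℝ) * l2Norm (X *ᵥ e) ^ 2
      ≤ 8 * lam * (√s * l2Norm e) + 2 * (η - lam) * l1Norm e := by
  have cross : 1 / (N : ℝ) * (E ⬝ᵥ X *ᵥ e) ≤ η * l1Norm e := by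
    calc 1 / (N : ℝ) * (E ⬝ᵥ X *ᵥ e) ≤ 1 / (N : ℝ) * (N * η * l1Norm e) := by
          rw [Matrix.dotProduct_mulVec]
          gcongr
          exact dotProduct_le_mul_l1Norm hnoise e
      _ = N / N * (η * l1Norm e) := by ring
      _ ≤ η * l1Norm e :=
          mul_le_of_le_one_left (mul_nonneg hη (l1Norm_nonneg e)) (div_self_le_one _)
  have half : 1 / (2 * (N : ℝ)) * l2Norm (X *ᵥ e) ^ 2
      = (1 / (N : ℝ) * l2Norm (X *ᵥ e) ^ 2) / 2 := by ring
  rw [SatisfiesBasicInequality, half] at h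
  linarith

/-- Restricted eigenvalue condition: the Gram matrix of `X` is bounded below by `κ` on the cone
`‖v‖₁² ≤ R ‖v‖₂²` of effectively `R`-sparse vectors. -/
def HasRestrictedEigenvalue (X : Matrix (Fin N) (Fin n) ℝ) (κ R : ℝ) : Prop :=
  ∀ v : Fin n → ℝ, l1Norm v ^ 2 ≤ R * l2Norm v ^ 2 →
    κ * l2Norm v ^ 2 ≤ 1 / (N : ℝ) * l2Norm (X *ᵥ v) ^ 2

lemma HasRestrictedEigenvalue.mono {κ' R' : ℝ} (h : HasRestrictedEigenvalue X κ R) (hκ : κ' ≤ κ)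
    (hR : R' ≤ R) : HasRestrictedEigenvalue X κ' R' := fun v hv =>
  (mul_le_mul_of_nonneg_right hκ (sq_nonneg _)).trans
    (h v (hv.trans (mul_le_mul_of_nonneg_right hR (sq_nonneg _))))

/-- The three error bounds of the Lasso at sparsity `s`, up to the factor `M`; here `τ` is the size
`σ √(log n / N)` of the noise. -/
structure HasErrorBounds (X : Matrix (Fin N) (Fin n) ℝ) (τ : ℝ) (s : ℕ) (M : ℝ)
    (e : Fin n → ℝ) : Prop where
  l2Norm_le : l2Norm e ≤ M * (τ * √s)
  l1Norm_le : l1Norm e ≤ M * (τ * s)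
  prediction_le : 1 / (N : ℝ) * l2Norm (X *ᵥ e) ^ 2 ≤ M * (τ ^ 2 * s)

lemma HasErrorBounds.mono {M M' : ℝ} (h : HasErrorBounds X τ s M e) (hτ : 0 ≤ τ) (hM : M ≤ M') :
    HasErrorBounds X τ s M' e where
  l2Norm_le := h.l2Norm_le.trans (by gcongr)
  l1Norm_le := h.l1Norm_le.trans (by gcongr)
  prediction_le := h.prediction_le.trans (by gcongr)

lemma HasRestrictedEigenvalue.hasErrorBounds (hX : HasRestrictedEigenvalue X κ R) (hκ : 0 < κ)
    (hB : 1 ≤ B) (hτ : 0 ≤ τ) (hcone : l1Norm e ^ 2 ≤ R * l2Norm e ^ 2)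
    (hl1 : l1Norm e ≤ B * (√s * l2Norm e))
    (hpred : 1 / (N : ℝ) * l2Norm (X *ᵥ e) ^ 2 ≤ B * τ * (√s * l2Norm e)) :
    HasErrorBounds X τ s (B ^ 2 / κ) e := by
  have hl2 : l2Norm e ≤ B / κ * (τ * √s) := by
    rcases (l2Norm_nonneg e).eq_or_lt' with h | h
    · rw [h]
      positivity
    · refine le_of_mul_le_mul_right ?_ (mul_pos hκ h)
      calc l2Norm e * (κ * l2Norm e) = κ * l2Norm e ^ 2 := by ring
        _ ≤ B * τ * (√s * l2Norm e) := (hX e hcone).trans hpred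
        _ = B / κ * (τ * √s) * (κ * l2Norm e) := by field_simp
  have hs : √(s : ℝ) * √s = s := Real.mul_self_sqrt (Nat.cast_nonneg s)
  refine ⟨hl2.trans ?_, hl1.trans ?_, hpred.trans ?_⟩
  · gcongr
    exact le_self_pow₀ hB two_ne_zero
  · calc B * (√s * l2Norm e) ≤ B * (√s * (B / κ * (τ * √s))) := by gcongr
      _ = B ^ 2 / κ * (τ * (√s * √s)) := by ring
      _ = B ^ 2 / κ * (τ * s) := by rw [hs]
  · calc B * τ * (√s * l2Norm e) ≤ B * τ * (√s * (B / κ * (τ * √s))) := by gcongr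
      _ = B ^ 2 / κ * (τ ^ 2 * (√s * √s)) := by ring
      _ = B ^ 2 / κ * (τ ^ 2 * s) := by rw [hs]

lemma SatisfiesBasicInequality.hasErrorBounds_of_noise_le_half {c₁ : ℝ}
    (h : SatisfiesBasicInequality X E lam s e) (hX : HasRestrictedEigenvalue X κ (64 * s))
    (hκ : 0 < κ) (hη : 0 ≤ η) (hnoise : ∀ a, |(E ᵥ* X) a| ≤ N * η) (hlam : 0 < lam)
    (hηlam : 2 * η ≤ lam) (hτ : 0 ≤ τ) (hlam_le : lam ≤ c₁ * τ) :
    HasErrorBounds X τ s ((8 * max c₁ 1) ^ 2 / κ) e := by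
  have he := l2Norm_nonneg e
  have hl1 := l1Norm_nonneg e
  have hpred := h.le_of_noise_le hη hnoise
  have hslack : 2 * (η - lam) * l1Norm e ≤ -lam * l1Norm e := by
    gcongr
    linarith
  have hcone : l1Norm e ≤ 8 * (√s * l2Norm e) := by
    have : 0 ≤ 1 / (N : ℝ) * l2Norm (X *ᵥ e) ^ 2 := by positivity
    exact le_of_mul_le_mul_left (by linarith) hlam
  have hc₁ : 1 ≤ max c₁ 1 := le_max_right _ _
  refine hX.hasErrorBounds hκ (by linarith) hτ ?_ (hcone.trans ?_) ?_
  · calc l1Norm e ^ 2 ≤ (8 * (√s * l2Norm e)) ^ 2 := by gcongr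
      _ = 64 * s * l2Norm e ^ 2 := by
        rw [mul_pow, mul_pow, Real.sq_sqrt (Nat.cast_nonneg s)]
        ring
  · gcongr
    linarith
  · have hlam_le' : lam ≤ max c₁ 1 * τ := hlam_le.trans (by gcongr; exact le_max_left _ _)
    calc 1 / (N : ℝ) * l2Norm (X *ᵥ e) ^ 2 ≤ 8 * lam * (√s * l2Norm e) := by
          have : 0 ≤ lam * l1Norm e := by positivity
          linarith
      _ ≤ 8 * (max c₁ 1 * τ) * (√s * l2Norm e) := by gcongr
      _ = 8 * max c₁ 1 * τ * (√s * l2Norm e) := by ring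

lemma SatisfiesBasicInequality.hasErrorBounds_of_card_le {c₁ A : ℝ} {n₀ : ℕ}
    (h : SatisfiesBasicInequality X E lam s e) (hX : HasRestrictedEigenvalue X κ n) (hκ : 0 < κ)
    (hA : 0 ≤ A) (hτ : 0 ≤ τ) (hnoise : ∀ a, |(E ᵥ* X) a| ≤ N * (A * τ)) (hlam : 0 ≤ lam)
    (hlam_le : lam ≤ c₁ * τ) (hs : 0 < s) (hn : n ≤ n₀) :
    HasErrorBounds X τ s ((8 * max c₁ 1 + (2 * A + 1) * √n₀) ^ 2 / κ) e := by
  have he := l2Norm_nonneg e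
  have hc₁ : 1 ≤ max c₁ 1 := le_max_right _ _
  have hl1 : l1Norm e ≤ √n * l2Norm e := by
    simpa using l1Norm_le_sqrt_card_mul_l2Norm e
  have hl1' : l1Norm e ≤ √n₀ * (√s * l2Norm e) := by
    have hs' : (1 : ℝ) ≤ √s := Real.one_le_sqrt.2 (by exact_mod_cast hs)
    calc l1Norm e ≤ √n * (1 * l2Norm e) := by rwa [one_mul]
      _ ≤ √n₀ * (√s * l2Norm e) := by gcongr
  have hB : 0 ≤ 8 * max c₁ 1 + 2 * A * √n₀ := by positivity
  refine hX.hasErrorBounds hκ ?_ hτ ?_ (hl1'.trans ?_) ?_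
  · have : 0 ≤ (2 * A + 1) * √n₀ := by positivity
    linarith
  · calc l1Norm e ^ 2 ≤ (√n * l2Norm e) ^ 2 := by
          have := l1Norm_nonneg e
          gcongr
      _ = n * l2Norm e ^ 2 := by rw [mul_pow, Real.sq_sqrt (Nat.cast_nonneg n)]
  · gcongr
    linarith
  · calc 1 / (N : ℝ) * l2Norm (X *ᵥ e) ^ 2
        ≤ 8 * lam * (√s * l2Norm e) + 2 * (A * τ - lam) * l1Norm e :=
          h.le_of_noise_le (by positivity) hnoise
      _ ≤ 8 * (max c₁ 1 * τ) * (√s * l2Norm e) + 2 * (A * τ) * (√n₀ * (√s * l2Norm e)) := by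
          have hlam_le' : lam ≤ max c₁ 1 * τ := hlam_le.trans (by gcongr; exact le_max_left _ _)
          have := l1Norm_nonneg e
          gcongr
          linarith
      _ ≤ (8 * max c₁ 1 + (2 * A + 1) * √n₀) * τ * (√s * l2Norm e) := by
          have : 0 ≤ √n₀ * τ * (√s * l2Norm e) := by positivity
          linarith

end BasicInequality

section Sparsification

lemma exists_le_sum_mul {ι : Type*} [Fintype ι] {p : ι → ℝ} (hp0 : ∀ i, 0 ≤ p i)
    (hp1 : ∑ i, p i = 1) (F : ι → ℝ) : ∃ i, F i ≤ ∑ i, p i * F i := by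
  obtain ⟨i, -, hi⟩ := (concaveOn_id convex_univ).exists_le_of_centerMass (t := Finset.univ)
    (w := p) (p := F) (fun i _ => hp0 i) (hp1 ▸ one_pos) fun i _ => Set.mem_univ _
  exact ⟨i, by simpa [Finset.centerMass_eq_of_sum_1 _ _ hp1] using hi⟩

section Bilinear

variable {V ι : Type*} [AddCommGroup V] [Module ℝ V] [Fintype ι] (B : LinearMap.BilinForm ℝ V)
  {p : ι → ℝ} {a : ι → V} {v : V}

lemma exists_bilin_add_sub_le (hp0 : ∀ i, 0 ≤ p i) (hp1 : ∑ i, p i = 1)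
    (hv : ∑ i, p i • a i = v) (w : V) :
    ∃ i, B (w + (a i - v)) (w + (a i - v)) ≤ B w w + (∑ i, p i * B (a i) (a i) - B v v) := by
  have mean_left (u : V) : ∑ i, p i * B (a i) u = B v u := by simp [← hv]
  have mean_right (u : V) : ∑ i, p i * B u (a i) = B u v := by simp [← hv]
  have expand (i : ι) : p i * B (w + (a i - v)) (w + (a i - v))
      = p i * (B w w - B w v - B v w + B v v) + p i * B w (a i) + p i * B (a i) w
        - p i * B (a i) v - p i * B v (a i) + p i * B (a i) (a i) := by
    simp only [map_add, map_sub, LinearMap.add_apply, LinearMap.sub_apply]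
    ring
  obtain ⟨i, hi⟩ := exists_le_sum_mul hp0 hp1 fun i => B (w + (a i - v)) (w + (a i - v))
  refine ⟨i, hi.trans_eq ?_⟩
  simp only [expand, Finset.sum_add_distrib, Finset.sum_sub_distrib, mean_left, mean_right,
    ← Finset.sum_mul, hp1]
  ring

lemma exists_bilin_add_sum_sub_le (hp0 : ∀ i, 0 ≤ p i) (hp1 : ∑ i, p i = 1)
    (hv : ∑ i, p i • a i = v) (m : ℕ) (w : V) :
    ∃ f : Fin m → ι, B (w + ∑ j, (a (f j) - v)) (w + ∑ j, (a (f j) - v))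
      ≤ B w w + m * (∑ i, p i * B (a i) (a i) - B v v) := by
  induction m generalizing w with
  | zero => exact ⟨Fin.elim0, by simp⟩
  | succ m ih =>
    obtain ⟨i, hi⟩ := exists_bilin_add_sub_le B hp0 hp1 hv w
    obtain ⟨f, hf⟩ := ih (w + (a i - v))
    refine ⟨Fin.cons i f, ?_⟩
    simp only [Fin.sum_univ_succ, Fin.cons_zero, Fin.cons_succ, ← add_assoc w]
    push_cast
    linarith

-- Maurey's empirical method: `v` is compared with the mean of `m + 1` sampled atoms.
lemma neg_sum_le_mul_bilin (hp0 : ∀ i, 0 ≤ p i) (hp1 : ∑ i, p i = 1) (hv : ∑ i, p i • a i = v)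
    {m : ℕ} (hB : ∀ f : Fin (m + 1) → ι, 0 ≤ B (∑ j, a (f j)) (∑ j, a (f j))) :
    -∑ i, p i * B (a i) (a i) ≤ m * B v v := by
  obtain ⟨f, hf⟩ := exists_bilin_add_sum_sub_le B hp0 hp1 hv (m + 1) (((m + 1 : ℕ) : ℝ) • v)
  have sum_atoms : ((m + 1 : ℕ) : ℝ) • v + ∑ j, (a (f j) - v) = ∑ j, a (f j) := by
    rw [Finset.sum_sub_distrib, Finset.sum_const, Finset.card_univ, Fintype.card_fin,
      Nat.cast_smul_eq_nsmul, add_sub_cancel]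
  rw [sum_atoms] at hf
  simp only [map_smul, LinearMap.smul_apply, smul_eq_mul] at hf
  push_cast at hf
  have hm : (0 : ℝ) < m + 1 := by positivity
  have : 0 ≤ (m + 1 : ℝ) * (m * B v v + ∑ i, p i * B (a i) (a i)) := by
    linarith [hB f]
  linarith [nonneg_of_mul_nonneg_right this hm]

end Bilinear

/-- The sum of the signed unit vectors listed by `g`; the zero sign contributes nothing. These
integer vectors form the net to which the restricted eigenvalue condition is reduced. -/
def signedSum {ι : Type*} [DecidableEq ι] {m : ℕ} (g : Fin m → ι × SignType) : ι → ℝ :=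
  ∑ j, Pi.single (g j).1 ((g j).2 : ℝ)

lemma neg_mul_l1Norm_sq_le_mul_bilin {ι : Type*} [Fintype ι] [DecidableEq ι]
    (B : LinearMap.BilinForm ℝ (ι → ℝ)) {Γ : ℝ} {m : ℕ} (hΓ : 0 ≤ Γ)
    (hdiag : ∀ i, B (Pi.single i 1) (Pi.single i 1) ≤ Γ)
    (hpos : ∀ g : Fin (m + 1) → ι × SignType, 0 ≤ B (signedSum g) (signedSum g)) (v : ι → ℝ) :
    -(l1Norm v ^ 2 * Γ) ≤ m * B v v := by
  set r := l1Norm v with hr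
  rcases (l1Norm_nonneg v).eq_or_lt' with h0 | hr0
  · have hv : v = 0 := by
      funext i
      simpa using (Finset.sum_eq_zero_iff_of_nonneg fun i _ => abs_nonneg (v i)).1 h0 i
        (Finset.mem_univ i)
    simp [hv, hr, l1Norm]
  let atom (i : ι) : ι → ℝ := r • Pi.single i (SignType.sign (v i) : ℝ)
  let weight (i : ι) : ℝ := |v i| / r
  have weight_nonneg (i : ι) : 0 ≤ weight i := by positivity
  have sum_weight : ∑ i, weight i = 1 := by
    rw [← Finset.sum_div]
    exact div_self hr0.ne'
  have mean : ∑ i, weight i • atom i = v := by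
    have h (i : ι) : weight i • atom i = Pi.single i (v i) := by
      rw [smul_smul, div_mul_cancel₀ _ hr0.ne', ← Pi.single_smul', smul_eq_mul, abs_mul_sign]
    simp only [h, Finset.univ_sum_single]
  have sum_atoms (f : Fin (m + 1) → ι) :
      ∑ j, atom (f j) = r • signedSum fun j => (f j, SignType.sign (v (f j))) :=
    (Finset.smul_sum).symm
  have bilin_atom (i : ι) : B (atom i) (atom i) ≤ r ^ 2 * Γ := by
    have hatom : atom i = (r * SignType.sign (v i)) • Pi.single i (1 : ℝ) := by
      rw [mul_smul, ← Pi.single_smul', smul_eq_mul, mul_one]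
    have hsign : (SignType.sign (v i) : ℝ) ^ 2 * B (Pi.single i 1) (Pi.single i 1) ≤ Γ := by
      rcases SignType.sign (v i) with _ | _ | _ <;> simp [hΓ, hdiag i]
    rw [hatom]
    simp only [map_smul, LinearMap.smul_apply, smul_eq_mul]
    linarith [mul_le_mul_of_nonneg_left hsign (sq_nonneg r)]
  refine le_trans (neg_le_neg ?_) (neg_sum_le_mul_bilin B weight_nonneg sum_weight mean
    fun f => ?_)
  · calc ∑ i, weight i * B (atom i) (atom i) ≤ ∑ i, weight i * (r ^ 2 * Γ) :=
          Finset.sum_le_sum fun i _ => mul_le_mul_of_nonneg_left (bilin_atom i) (weight_nonneg i)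
      _ = r ^ 2 * Γ := by rw [← Finset.sum_mul, sum_weight, one_mul]
  · rw [sum_atoms]
    simp only [map_smul, LinearMap.smul_apply, smul_eq_mul]
    exact mul_nonneg hr0.le (mul_nonneg hr0.le (hpos _))

variable {N n : ℕ}

lemma gram_bilin_apply (X : Matrix (Fin N) (Fin n) ℝ) (κ : ℝ) (x : Fin n → ℝ) :
    Matrix.toBilin' ((1 / (N : ℝ)) • (Xᵀ * X) - κ • 1) x x
      = 1 / (N : ℝ) * l2Norm (X *ᵥ x) ^ 2 - κ * l2Norm x ^ 2 := by
  rw [Matrix.toBilin'_apply', Matrix.sub_mulVec, Matrix.smul_mulVec, Matrix.smul_mulVec,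
    Matrix.one_mulVec, dotProduct_sub, dotProduct_smul, dotProduct_smul, smul_eq_mul, smul_eq_mul,
    ← Matrix.mulVec_mulVec, Matrix.dotProduct_mulVec x Xᵀ, Matrix.vecMul_transpose,
    l2Norm_sq_eq_dotProduct, l2Norm_sq_eq_dotProduct]

lemma hasRestrictedEigenvalue_of_signedSum {X : Matrix (Fin N) (Fin n) ℝ} {κ Γ R : ℝ} {m : ℕ}
    (hm : 0 < m) (hκ : 0 ≤ κ) (hΓ : 0 ≤ Γ) (hcol : ∀ a, ∑ i, X i a ^ 2 ≤ N * Γ)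
    (hpts : ∀ g : Fin (m + 1) → Fin n × SignType,
      κ * l2Norm (signedSum g) ^ 2 ≤ 1 / (N : ℝ) * l2Norm (X *ᵥ signedSum g) ^ 2) :
    HasRestrictedEigenvalue X (κ - Γ * R / m) R := by
  intro v hv
  set B := Matrix.toBilin' ((1 / (N : ℝ)) • (Xᵀ * X) - κ • 1) with hB
  have hdiag (a : Fin n) : B (Pi.single a 1) (Pi.single a 1) ≤ Γ := by
    rw [hB, gram_bilin_apply]
    calc 1 / (N : ℝ) * l2Norm (X *ᵥ Pi.single a 1) ^ 2 - κ * l2Norm (Pi.single a 1) ^ 2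
        ≤ 1 / (N : ℝ) * l2Norm (X *ᵥ Pi.single a 1) ^ 2 := sub_le_self _ (by positivity)
      _ ≤ 1 / (N : ℝ) * (N * Γ) := by
          gcongr
          simpa [l2Norm_sq] using hcol a
      _ = N / N * Γ := by ring
      _ ≤ Γ := mul_le_of_le_one_left hΓ (div_self_le_one _)
  have hsparse := neg_mul_l1Norm_sq_le_mul_bilin B hΓ hdiag
    (fun g => by rw [hB, gram_bilin_apply]; exact sub_nonneg.2 (hpts g)) v
  rw [hB, gram_bilin_apply] at hsparse
  have hm' : (0 : ℝ) < m := by exact_mod_cast hm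
  have hcone : -(Γ * R / m * l2Norm v ^ 2)
      ≤ 1 / (N : ℝ) * l2Norm (X *ᵥ v) ^ 2 - κ * l2Norm v ^ 2 := by
    refine le_of_mul_le_mul_left ?_ hm'
    calc (m : ℝ) * -(Γ * R / m * l2Norm v ^ 2) = -(R * l2Norm v ^ 2 * Γ) := by field_simp
      _ ≤ -(l1Norm v ^ 2 * Γ) := neg_le_neg (by gcongr)
      _ ≤ _ := hsparse
  linarith

end Sparsification

section SubGaussian

open scoped NNReal

variable {Ω : Type*} [MeasurableSpace Ω] {P : Measure Ω} {W : Ω → ℝ} {v : ℝ≥0}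

lemma IsSubGaussian.hasSubgaussianMGF {σ : ℝ} (h : IsSubGaussian σ W P) :
    HasSubgaussianMGF W (.mk (σ ^ 2) (sq_nonneg σ)) P :=
  ⟨h.integrable_exp, h.mgf_le⟩

lemma lintegral_exp_sq_gaussianReal (hv : 0 < v) :
    ∫⁻ g, ENNReal.ofReal (Real.exp (v * g ^ 2 / 2)) ∂gaussianReal 0 (2 * v)⁻¹
      = ENNReal.ofReal √2 := by
  have : (0 : ℝ) < v := hv
  have hw : ((2 * v)⁻¹ : ℝ≥0) ≠ 0 := by positivity
  have density (g : ℝ) : gaussianPDFReal 0 (2 * v)⁻¹ g * Real.exp (v * g ^ 2 / 2)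
      = (√(Real.pi / v))⁻¹ * Real.exp (-(v / 2) * g ^ 2) := by
    rw [gaussianPDFReal, mul_assoc, ← Real.exp_add]
    push_cast
    congr 2
    · congr 1
      field_simp
    · field_simp
      ring
  rw [gaussianReal_of_var_ne_zero _ hw, lintegral_withDensity_eq_lintegral_mul _
    (measurable_gaussianPDF _ _) (by fun_prop)]
  simp only [Pi.mul_apply, gaussianPDF, ← ENNReal.ofReal_mul (gaussianPDFReal_nonneg _ _ _),
    density]
  rw [← ofReal_integral_eq_lintegral_ofReal
    ((integrable_exp_neg_mul_sq (by positivity)).const_mul _)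
    (Eventually.of_forall fun _ => by positivity), integral_const_mul, integral_gaussian,
    ← Real.sqrt_inv, ← Real.sqrt_mul (by positivity)]
  congr 2
  field_simp

-- `exp (w² / (4v))` is the moment generating function of a Gaussian variable at `w`; exchanging
-- the two expectations brings in the moment generating function of `W`.
lemma lintegral_exp_sq_le [SFinite P] (hv : 0 < v) (h : HasSubgaussianMGF W v P) :
    ∫⁻ ω, ENNReal.ofReal (Real.exp (W ω ^ 2 / (4 * v))) ∂P ≤ ENNReal.ofReal √2 := by
  have : (0 : ℝ) < v := hv
  have hW : AEMeasurable W P := h.aemeasurable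
  have linearize (w : ℝ) : ENNReal.ofReal (Real.exp (w ^ 2 / (4 * v)))
      = ∫⁻ g, ENNReal.ofReal (Real.exp (w * g)) ∂gaussianReal 0 (2 * v)⁻¹ := by
    rw [← ofReal_integral_eq_lintegral_ofReal (integrable_exp_mul_gaussianReal _)
      (Eventually.of_forall fun _ => (Real.exp_pos _).le)]
    have hmgf := congrFun (mgf_id_gaussianReal (μ := 0) (v := (2 * v)⁻¹)) w
    simp only [mgf, id] at hmgf
    rw [hmgf]
    push_cast
    congr 2
    field_simp
    ring
  have inner (g : ℝ) : ∫⁻ ω, ENNReal.ofReal (Real.exp (W ω * g)) ∂P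
      ≤ ENNReal.ofReal (Real.exp (v * g ^ 2 / 2)) := by
    simp only [mul_comm (W _) g]
    rw [← ofReal_integral_eq_lintegral_ofReal (h.integrable_exp_mul g)
      (Eventually.of_forall fun _ => (Real.exp_pos _).le)]
    exact ENNReal.ofReal_le_ofReal (h.mgf_le g)
  calc ∫⁻ ω, ENNReal.ofReal (Real.exp (W ω ^ 2 / (4 * v))) ∂P
      = ∫⁻ g, ∫⁻ ω, ENNReal.ofReal (Real.exp (W ω * g)) ∂P ∂gaussianReal 0 (2 * v)⁻¹ := by
        simp only [linearize]
        exact lintegral_lintegral_swap (by fun_prop)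
    _ ≤ ∫⁻ g, ENNReal.ofReal (Real.exp (v * g ^ 2 / 2)) ∂gaussianReal 0 (2 * v)⁻¹ :=
        lintegral_mono inner
    _ = ENNReal.ofReal √2 := lintegral_exp_sq_gaussianReal hv

lemma integrable_exp_sq [SFinite P] (hv : 0 < v) (h : HasSubgaussianMGF W v P) :
    Integrable (fun ω => Real.exp (W ω ^ 2 / (4 * v))) P := by
  have := h.aemeasurable
  rw [← lintegral_ofReal_ne_top_iff_integrable (by fun_prop)
    (Eventually.of_forall fun _ => (Real.exp_pos _).le)]
  exact ((lintegral_exp_sq_le hv h).trans_lt ENNReal.ofReal_lt_top).ne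

lemma integral_exp_sq_le [SFinite P] (hv : 0 < v) (h : HasSubgaussianMGF W v P) :
    ∫ ω, Real.exp (W ω ^ 2 / (4 * v)) ∂P ≤ √2 := by
  rw [← ENNReal.ofReal_le_ofReal_iff (Real.sqrt_nonneg 2),
    ofReal_integral_eq_lintegral_ofReal (integrable_exp_sq hv h)
      (Eventually.of_forall fun _ => (Real.exp_pos _).le)]
  exact lintegral_exp_sq_le hv h

lemma integral_pow_four_le [SFinite P] (hv : 0 < v) (h : HasSubgaussianMGF W v P) :
    ∫ ω, W ω ^ 4 ∂P ≤ 48 * v ^ 2 := by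
  have : (0 : ℝ) < v := hv
  have pointwise (ω : Ω) : W ω ^ 4 ≤ 32 * v ^ 2 * Real.exp (W ω ^ 2 / (4 * v)) := by
    have hexp := Real.quadratic_le_exp_of_nonneg (x := W ω ^ 2 / (4 * v)) (by positivity)
    have hnn : 0 ≤ W ω ^ 2 / (4 * v) := by positivity
    calc W ω ^ 4 = 32 * v ^ 2 * ((W ω ^ 2 / (4 * v)) ^ 2 / 2) := by
          field_simp
          ring
      _ ≤ 32 * v ^ 2 * Real.exp (W ω ^ 2 / (4 * v)) := by
          gcongr
          linarith
  calc ∫ ω, W ω ^ 4 ∂P ≤ ∫ ω, 32 * v ^ 2 * Real.exp (W ω ^ 2 / (4 * v)) ∂P :=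
        integral_mono_of_nonneg (Eventually.of_forall fun ω => by positivity)
          ((integrable_exp_sq hv h).const_mul _) (Eventually.of_forall pointwise)
    _ ≤ 32 * v ^ 2 * (3 / 2) := by
        rw [integral_const_mul]
        gcongr
        exact (integral_exp_sq_le hv h).trans Real.sqrt_two_lt_three_halves.le
    _ = 48 * v ^ 2 := by ring

lemma exp_neg_le_quadratic {x : ℝ} (hx : 0 ≤ x) : Real.exp (-x) ≤ 1 - x + x ^ 2 / 2 := by
  have hpos : 0 ≤ 1 - x + x ^ 2 / 2 := by nlinarith [sq_nonneg (x - 1)]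
  rw [Real.exp_neg, inv_le_iff_one_le_mul₀ (Real.exp_pos x)]
  calc (1 : ℝ) ≤ (1 - x + x ^ 2 / 2) * (1 + x + x ^ 2 / 2) := by nlinarith [sq_nonneg (x ^ 2)]
    _ ≤ (1 - x + x ^ 2 / 2) * Real.exp x := by
        gcongr
        exact Real.quadratic_le_exp_of_nonneg hx

lemma integrable_exp_mul_neg_sq [IsFiniteMeasure P] {θ : ℝ} (hW : AEMeasurable W P)
    (hθ : 0 ≤ θ) : Integrable (fun ω => Real.exp (θ * -(W ω ^ 2))) P := by
  refine (integrable_const 1).mono' (by fun_prop) (Eventually.of_forall fun ω => ?_)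
  rw [Real.norm_of_nonneg (Real.exp_pos _).le, Real.exp_le_one_iff, mul_neg]
  exact neg_nonpos.2 (by positivity)

lemma mgf_neg_sq_le [IsProbabilityMeasure P] {c θ : ℝ} (hv : 0 < v)
    (h : HasSubgaussianMGF W v P) (hc : c ≤ ∫ ω, W ω ^ 2 ∂P) (hθ : 0 ≤ θ) :
    mgf (fun ω => -(W ω ^ 2)) P θ ≤ Real.exp (-(θ * c) + 24 * θ ^ 2 * v ^ 2) := by
  have hint2 : Integrable (fun ω => W ω ^ 2) P := (h.memLp 2).integrable_sq
  have hint4 : Integrable (fun ω => W ω ^ 4) P := by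
    simpa [Even.pow_abs (by decide : Even 4)] using
      (h.memLp 4).integrable_norm_pow (by norm_num)
  have pointwise (ω : Ω) :
      Real.exp (θ * -(W ω ^ 2)) ≤ 1 - θ * W ω ^ 2 + θ ^ 2 / 2 * W ω ^ 4 := by
    have hexp := exp_neg_le_quadratic (x := θ * W ω ^ 2) (by positivity)
    rw [mul_neg]
    linarith
  have hint : Integrable (fun ω => 1 - θ * W ω ^ 2) P :=
    (integrable_const 1).sub (hint2.const_mul θ)
  calc mgf (fun ω => -(W ω ^ 2)) P θ
      ≤ ∫ ω, (1 - θ * W ω ^ 2 + θ ^ 2 / 2 * W ω ^ 4) ∂P :=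
        integral_mono (integrable_exp_mul_neg_sq h.aemeasurable hθ)
          (hint.add (hint4.const_mul _)) pointwise
    _ = 1 - θ * ∫ ω, W ω ^ 2 ∂P + θ ^ 2 / 2 * ∫ ω, W ω ^ 4 ∂P := by
        rw [integral_add hint (hint4.const_mul _),
          integral_sub (integrable_const 1) (hint2.const_mul θ), integral_const_mul,
          integral_const_mul]
        simp
    _ ≤ 1 - θ * c + θ ^ 2 / 2 * (48 * v ^ 2) := by
        gcongr
        exact integral_pow_four_le hv h
    _ ≤ Real.exp (-(θ * c) + 24 * θ ^ 2 * v ^ 2) := by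
        linarith [Real.add_one_le_exp (-(θ * c) + 24 * θ ^ 2 * v ^ 2)]

section Sums

variable {ι : Type*} [Fintype ι] {Y : ι → Ω → ℝ}

lemma measureReal_le_sum_le_exp [IsProbabilityMeasure P] {θ a : ℝ} (hind : iIndepFun Y P)
    (hY : ∀ i, Measurable (Y i)) (hθ : 0 ≤ θ)
    (hint : ∀ i, Integrable (fun ω => Real.exp (θ * Y i ω)) P)
    (hmgf : ∀ i, mgf (Y i) P θ ≤ Real.exp a) (t : ℝ) :
    P.real {ω | Fintype.card ι * t ≤ ∑ i, Y i ω}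
      ≤ Real.exp (Fintype.card ι * (a - θ * t)) := by
  have chernoff := measure_ge_le_exp_mul_mgf (Fintype.card ι * t) hθ
    (hind.integrable_exp_mul_sum (s := Finset.univ) hY fun i _ => hint i)
  rw [hind.mgf_sum hY] at chernoff
  simp only [Finset.sum_apply] at chernoff
  calc _ ≤ Real.exp (-θ * (Fintype.card ι * t)) * ∏ i, mgf (Y i) P θ := chernoff
    _ ≤ Real.exp (-θ * (Fintype.card ι * t)) * ∏ _i : ι, Real.exp a := by
        gcongr with i
        · exact fun i _ => mgf_nonneg
        · exact hmgf i
    _ = Real.exp (Fintype.card ι * (a - θ * t)) := by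
        rw [Finset.prod_const, Finset.card_univ, ← Real.exp_nat_mul, ← Real.exp_add]
        congr 1
        ring

lemma measureReal_le_sum_sq_le_exp [IsProbabilityMeasure P] (hv : 0 < v) (hind : iIndepFun Y P)
    (hY : ∀ i, Measurable (Y i)) (h : ∀ i, HasSubgaussianMGF (Y i) v P) :
    P.real {ω | Fintype.card ι * (8 * v) ≤ ∑ i, Y i ω ^ 2}
      ≤ Real.exp (-Fintype.card ι) := by
  have : (0 : ℝ) < v := hv
  have rescale (x : ℝ) : (4 * v : ℝ)⁻¹ * x ^ 2 = x ^ 2 / (4 * v) := inv_mul_eq_div _ _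
  refine (measureReal_le_sum_le_exp (θ := (4 * v : ℝ)⁻¹) (a := 1)
    (hind.comp (fun _ x => x ^ 2) fun _ => by fun_prop) (fun i => (hY i).pow_const 2)
    (by positivity) (fun i => ?_) (fun i => ?_) _).trans_eq ?_
  · simpa only [Function.comp_apply, rescale] using integrable_exp_sq hv (h i)
  · simp only [mgf, Function.comp_apply, rescale]
    have := Real.add_one_le_exp 1
    linarith [integral_exp_sq_le hv (h i), Real.sqrt_two_lt_three_halves]
  · congr 1
    field_simp
    norm_num

lemma measureReal_sum_sq_le_le_exp [IsProbabilityMeasure P] {c : ℝ} (hv : 0 < v) (hc : 0 ≤ c)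
    (hind : iIndepFun Y P) (hY : ∀ i, Measurable (Y i))
    (h : ∀ i, HasSubgaussianMGF (Y i) v P) (hvar : ∀ i, c ≤ ∫ ω, Y i ω ^ 2 ∂P) :
    P.real {ω | ∑ i, Y i ω ^ 2 ≤ Fintype.card ι * (c / 2)}
      ≤ Real.exp (-(Fintype.card ι * (c ^ 2 / (384 * v ^ 2)))) := by
  have : (0 : ℝ) < v := hv
  -- `θ = c / (96 v²)` minimizes the exponent `-θ c + 24 θ² v² + θ c / 2`.
  have hθ : 0 ≤ c / (96 * v ^ 2) := by positivity
  have chernoff := measureReal_le_sum_le_exp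
    (hind.comp (fun _ x => -(x ^ 2)) fun _ => by fun_prop) (fun i => ((hY i).pow_const 2).neg) hθ
    (fun i => integrable_exp_mul_neg_sq (h i).aemeasurable hθ)
    (fun i => mgf_neg_sq_le hv (h i) (hvar i) hθ) (-(c / 2))
  simp only [Function.comp_apply, Finset.sum_neg_distrib, mul_neg, neg_le_neg_iff] at chernoff
  refine chernoff.trans_eq ?_
  congr 1
  field_simp
  ring

lemma measureReal_lt_abs_le [IsFiniteMeasure P] {t : ℝ} (h : HasSubgaussianMGF W v P)
    (ht : 0 ≤ t) : P.real {ω | t < |W ω|} ≤ 2 * Real.exp (-t ^ 2 / (2 * v)) := by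
  have tails : {ω | t < |W ω|} ⊆ {ω | t ≤ W ω} ∪ {ω | t ≤ (-W) ω} := fun ω hω =>
    (lt_abs.1 (show t < |W ω| from hω)).imp (fun h => h.le) (fun h => h.le)
  calc _ ≤ P.real {ω | t ≤ W ω} + P.real {ω | t ≤ (-W) ω} :=
        (measureReal_mono tails).trans (measureReal_union_le _ _)
    _ ≤ Real.exp (-t ^ 2 / (2 * v)) + Real.exp (-t ^ 2 / (2 * v)) :=
        add_le_add (h.measure_ge_le ht) (h.neg.measure_ge_le ht)
    _ = 2 * Real.exp (-t ^ 2 / (2 * v)) := (two_mul _).symm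

lemma hasSubgaussianMGF_dotProduct {V : ℝ≥0} (hind : iIndepFun Y P)
    (h : ∀ i, HasSubgaussianMGF (Y i) v P) {z : ι → ℝ} (hz : ∑ i, z i ^ 2 ≤ V) :
    HasSubgaussianMGF (fun ω => z ⬝ᵥ fun i => Y i ω) (v * V) P := by
  have hsum := HasSubgaussianMGF.sum_of_iIndepFun
    (hind.comp (fun i x => z i * x) fun _ => by fun_prop) (s := Finset.univ)
    fun i _ => (h i).const_mul (z i)
  have hvar : ∑ i, z i ^ 2 * (v : ℝ) ≤ v * V := by
    rw [← Finset.sum_mul, mul_comm]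
    gcongr
  refine ⟨hsum.integrable_exp_mul, fun t => (hsum.mgf_le t).trans (Real.exp_le_exp.2 ?_)⟩
  gcongr
  exact (NNReal.coe_sum _ _).trans_le hvar

end Sums

lemma measure_pair_mem_le {α β : Type*} [MeasurableSpace α] [MeasurableSpace β]
    [IsProbabilityMeasure P] {X : Ω → α} {Y : Ω → β} (hX : Measurable X) (hY : Measurable Y)
    (hind : IndepFun X Y P) {T : Set (α × β)} (hT : MeasurableSet T) {δ : ENNReal}
    (hδ : ∀ x, P {ω | (x, Y ω) ∈ T} ≤ δ) : P {ω | (X ω, Y ω) ∈ T} ≤ δ := by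
  have := Measure.isProbabilityMeasure_map (μ := P) hX.aemeasurable
  have := Measure.isProbabilityMeasure_map (μ := P) hY.aemeasurable
  calc P {ω | (X ω, Y ω) ∈ T} = (P.map X).prod (P.map Y) T := by
        rw [← (indepFun_iff_map_prod_eq_prod_map_map hX.aemeasurable hY.aemeasurable).1 hind,
          Measure.map_apply (hX.prodMk hY) hT]
        rfl
    _ ≤ ∫⁻ _, δ ∂P.map X := by
        rw [Measure.prod_apply hT]
        refine lintegral_mono fun x => ?_
        rw [Measure.map_apply hY (measurable_prodMk_left hT)]
        exact hδ x
    _ = δ := by simp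

lemma measureReal_lt_abs_dotProduct_le [IsProbabilityMeasure P] {ι : Type*} [Fintype ι]
    {Y Z : Ω → ι → ℝ} {V : ℝ≥0} {t : ℝ} (hZ : Measurable Z) (hY : Measurable Y)
    (hZY : IndepFun Z Y P) (hind : iIndepFun (fun i ω => Y ω i) P)
    (h : ∀ i, HasSubgaussianMGF (fun ω => Y ω i) v P) (ht : 0 ≤ t) :
    P.real {ω | ∑ i, Z ω i ^ 2 ≤ V ∧ t < |Z ω ⬝ᵥ Y ω|}
      ≤ 2 * Real.exp (-t ^ 2 / (2 * (v * V))) := by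
  let T : Set ((ι → ℝ) × (ι → ℝ)) := {p | ∑ i, p.1 i ^ 2 ≤ V ∧ t < |p.1 ⬝ᵥ p.2|}
  have hT : MeasurableSet T := by
    have hdot : Measurable fun p : (ι → ℝ) × (ι → ℝ) => |p.1 ⬝ᵥ p.2| := by
      simp only [dotProduct]
      fun_prop
    exact (measurableSet_le (f := fun p : (ι → ℝ) × (ι → ℝ) => ∑ i, p.1 i ^ 2) (by fun_prop)
      measurable_const).inter (measurableSet_lt measurable_const hdot)
  refine ENNReal.toReal_le_of_le_ofReal (by positivity)
    (measure_pair_mem_le (T := T) hZ hY hZY hT fun z => ?_)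
  by_cases hz : ∑ i, z i ^ 2 ≤ V
  · refine (ENNReal.le_ofReal_iff_toReal_le (measure_ne_top _ _) (by positivity)).2 ?_
    refine (measureReal_mono fun ω hω => ?_).trans
      (measureReal_lt_abs_le (hasSubgaussianMGF_dotProduct hind h hz) ht)
    exact hω.2
  · have hempty : {ω | (z, Y ω) ∈ T} = ∅ := Set.eq_empty_of_forall_notMem fun ω hω => hz hω.1
    rw [hempty, measure_empty]
    exact zero_le

end SubGaussian

section Design

variable {Ω : Type*} [MeasurableSpace Ω] {P : Measure Ω} {n N : ℕ}

lemma IsSubGaussianVec.coord {σ : ℝ} {Z : Ω → Fin n → ℝ} (h : IsSubGaussianVec σ Z P)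
    (a : Fin n) : IsSubGaussian σ (fun ω => Z ω a) P := by
  have unit : l2Norm (Pi.single a (1 : ℝ)) = 1 := by simp [l2Norm, Pi.single_apply]
  simpa using h.dot (Pi.single a 1) unit

lemma IsSubGaussianVec.integral_dotProduct_sq [IsProbabilityMeasure P] {σ : ℝ}
    {Z : Ω → Fin n → ℝ} {S : Matrix (Fin n) (Fin n) ℝ} (h : IsSubGaussianVec σ Z P)
    (hS : ∀ a b, cov[fun ω => Z ω a, fun ω => Z ω b; P] = S a b) {u : Fin n → ℝ}
    (hu : l2Norm u = 1) : ∫ ω, (u ⬝ᵥ Z ω) ^ 2 ∂P = u ⬝ᵥ S *ᵥ u := by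
  have hcoord (a : Fin n) : MemLp (fun ω => u a * Z ω a) 2 P :=
    ((h.coord a).hasSubgaussianMGF.memLp 2).const_mul (u a)
  have hdot : MemLp (fun ω => u ⬝ᵥ Z ω) 2 P := (h.dot u hu).hasSubgaussianMGF.memLp 2
  calc ∫ ω, (u ⬝ᵥ Z ω) ^ 2 ∂P = Var[fun ω => u ⬝ᵥ Z ω; P] := by
        rw [variance_eq_integral hdot.aemeasurable, (h.dot u hu).mean_zero]
        simp only [sub_zero]
    _ = ∑ a, ∑ b, u b * (u a * S a b) := by
        simp only [dotProduct]
        rw [variance_fun_sum hcoord]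
        simp only [covariance_const_mul_left, covariance_const_mul_right, hS]
    _ = u ⬝ᵥ S *ᵥ u := by
        simp only [dotProduct, Matrix.mulVec, Finset.mul_sum]
        exact Finset.sum_congr rfl fun a _ => Finset.sum_congr rfl fun b _ => by ring

open scoped MatrixOrder in
lemma mul_l2Norm_sq_le_dotProduct_mulVec {S : Matrix (Fin n) (Fin n) ℝ} {c : ℝ}
    (hS : S.IsHermitian) (hspec : spectrum ℝ S ⊆ Set.Ici c) (u : Fin n → ℝ) :
    c * l2Norm u ^ 2 ≤ u ⬝ᵥ S *ᵥ u := by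
  have hpos : (S - algebraMap ℝ _ c).PosSemidef :=
    (algebraMap_le_iff_le_spectrum (ha := hS)).2 fun x hx => hspec hx
  have := hpos.dotProduct_mulVec_nonneg u
  rw [Algebra.algebraMap_eq_smul_one, Matrix.sub_mulVec, Matrix.smul_mulVec, Matrix.one_mulVec,
    dotProduct_sub, dotProduct_smul, star_trivial, smul_eq_mul, ← l2Norm_sq_eq_dotProduct] at this
  exact sub_nonneg.1 this

namespace IsRowwiseSubGaussian

variable {σ c : ℝ} {S : Matrix (Fin n) (Fin n) ℝ} {X : Ω → Matrix (Fin N) (Fin n) ℝ}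

lemma le_integral_dotProduct_sq [IsProbabilityMeasure P] (hX : IsRowwiseSubGaussian σ S X P)
    (hspec : spectrum ℝ S ⊆ Set.Ici c) {u : Fin n → ℝ} (hu : l2Norm u = 1) (i : Fin N) :
    c ≤ ∫ ω, (u ⬝ᵥ X ω i) ^ 2 ∂P := by
  have hS : S.IsHermitian := by
    ext a b
    rw [Matrix.conjTranspose_apply, star_trivial, ← hX.covariance i, ← hX.covariance i,
      covariance_comm]
  rw [(hX.subGaussian i).integral_dotProduct_sq (hX.covariance i) hu]
  simpa [hu] using mul_l2Norm_sq_le_dotProduct_mulVec hS hspec u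

lemma measureReal_l2Norm_mulVec_sq_lt_le_exp [IsProbabilityMeasure P]
    (hX : IsRowwiseSubGaussian σ S X P) (hσ : 0 < σ) (hc : 0 ≤ c)
    (hspec : spectrum ℝ S ⊆ Set.Ici c) (w : Fin n → ℝ) :
    P.real {ω | l2Norm (X ω *ᵥ w) ^ 2 < N * (c / 2) * l2Norm w ^ 2}
      ≤ Real.exp (-(N * (c ^ 2 / (384 * σ ^ 4)))) := by
  rcases (l2Norm_nonneg w).eq_or_lt' with h0 | hw
  · have hempty : {ω | l2Norm (X ω *ᵥ w) ^ 2 < N * (c / 2) * l2Norm w ^ 2} = ∅ :=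
      Set.eq_empty_of_forall_notMem fun ω hω => (sq_nonneg (l2Norm (X ω *ᵥ w))).not_gt <| by
        simpa [h0] using hω
    rw [hempty, measureReal_empty]
    positivity
  obtain ⟨u, hu, hwu⟩ : ∃ u, l2Norm u = 1 ∧ w = l2Norm w • u :=
    ⟨(l2Norm w)⁻¹ • w, by rw [l2Norm_smul, abs_inv, abs_of_pos hw, inv_mul_cancel₀ hw.ne'],
      (smul_inv_smul₀ hw.ne' w).symm⟩
  have hdot : Measurable fun z : Fin n → ℝ => u ⬝ᵥ z := by
    simp only [dotProduct]
    fun_prop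
  have tail := measureReal_sum_sq_le_le_exp (v := (.mk (σ ^ 2) (sq_nonneg σ))) (pow_pos hσ 2) hc
    (hX.indep.comp (fun _ z => u ⬝ᵥ z) fun _ => hdot)
    (fun i => hdot.comp (measurable_pi_iff.2 (hX.measurable i)))
    (fun i => ((hX.subGaussian i).dot u hu).hasSubgaussianMGF)
    (hX.le_integral_dotProduct_sq hspec hu)
  simp only [Fintype.card_fin, NNReal.coe_mk, ← pow_mul, Function.comp_apply] at tail
  refine (measureReal_mono fun ω hω => ?_).trans tail
  have scale : l2Norm (X ω *ᵥ w) ^ 2 = (∑ i, (u ⬝ᵥ X ω i) ^ 2) * l2Norm w ^ 2 := by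
    calc l2Norm (X ω *ᵥ w) ^ 2 = l2Norm (l2Norm w • (X ω *ᵥ u)) ^ 2 := by
          rw [← Matrix.mulVec_smul, ← hwu]
      _ = l2Norm (X ω *ᵥ u) ^ 2 * l2Norm w ^ 2 := by
          rw [l2Norm_smul, mul_pow, sq_abs, mul_comm]
      _ = (∑ i, (u ⬝ᵥ X ω i) ^ 2) * l2Norm w ^ 2 := by
          simp only [l2Norm_sq, Matrix.mulVec, dotProduct_comm u]
  rw [Set.mem_ofPred_eq, scale] at hω
  exact (lt_of_mul_lt_mul_right hω (sq_nonneg _)).le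

lemma measureReal_exists_signedSum_lt_le_exp [IsProbabilityMeasure P]
    (hX : IsRowwiseSubGaussian σ S X P) (hσ : 0 < σ) (hc : 0 ≤ c)
    (hspec : spectrum ℝ S ⊆ Set.Ici c) (m : ℕ) :
    P.real {ω | ∃ g : Fin m → Fin n × SignType,
        l2Norm (X ω *ᵥ signedSum g) ^ 2 < N * (c / 2) * l2Norm (signedSum g) ^ 2}
      ≤ (3 * n) ^ m * Real.exp (-(N * (c ^ 2 / (384 * σ ^ 4)))) := by
  have card_sign : Fintype.card SignType = 3 := rfl
  rw [Set.ofPred_exists]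
  refine (measureReal_iUnion_fintype_le _).trans ((Finset.sum_le_sum fun g _ =>
    hX.measureReal_l2Norm_mulVec_sq_lt_le_exp hσ hc hspec (signedSum g)).trans_eq ?_)
  simp [card_sign, mul_comm]

lemma measureReal_exists_column_le_exp [IsProbabilityMeasure P]
    (hX : IsRowwiseSubGaussian σ S X P) (hσ : 0 < σ) :
    P.real {ω | ∃ a, N * (8 * σ ^ 2) ≤ ∑ i, X ω i a ^ 2} ≤ n * Real.exp (-N) := by
  rw [Set.ofPred_exists]
  refine (measureReal_iUnion_fintype_le _).trans ((Finset.sum_le_sum fun a _ => ?_).trans_eq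
    (by simp : ∑ _a : Fin n, Real.exp (-N) = n * Real.exp (-N)))
  simpa using measureReal_le_sum_sq_le_exp (v := (.mk (σ ^ 2) (sq_nonneg σ))) (pow_pos hσ 2)
    (hX.indep.comp (fun _ z => z a) fun _ => measurable_pi_apply a) (fun i => hX.measurable i a)
    fun i => ((hX.subGaussian i).coord a).hasSubgaussianMGF

lemma measureReal_not_hasRestrictedEigenvalue_le [IsProbabilityMeasure P]
    (hX : IsRowwiseSubGaussian σ S X P) (hσ : 0 < σ) (hc : 0 ≤ c)
    (hspec : spectrum ℝ S ⊆ Set.Ici c) (hN : 0 < N) {m : ℕ} (hm : 0 < m) (R : ℝ) :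
    P.real {ω | ¬ HasRestrictedEigenvalue (X ω) (c / 2 - 8 * σ ^ 2 * R / m) R}
      ≤ (3 * n) ^ (m + 1) * Real.exp (-(N * (c ^ 2 / (384 * σ ^ 4)))) + n * Real.exp (-N) := by
  refine (measureReal_mono fun ω hω => ?_).trans ((measureReal_union_le _ _).trans (add_le_add
    (hX.measureReal_exists_signedSum_lt_le_exp hσ hc hspec (m + 1))
    (hX.measureReal_exists_column_le_exp hσ)))
  by_contra hgood
  simp only [Set.mem_union, Set.mem_ofPred_eq, not_or, not_exists, not_lt, not_le] at hgood
  refine hω (hasRestrictedEigenvalue_of_signedSum hm (by positivity) (by positivity)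
    (fun a => (hgood.2 a).le) fun g => ?_)
  have hN' : (0 : ℝ) < N := by exact_mod_cast hN
  rw [one_div, ← div_eq_inv_mul, le_div_iff₀ hN']
  linarith [hgood.1 g]

lemma measureReal_exists_lt_abs_vecMul_le [IsProbabilityMeasure P]
    (hX : IsRowwiseSubGaussian σ S X P) (hσ : 0 < σ) {σε η : ℝ} {ε : Ω → Fin N → ℝ}
    (hε : IsSubGaussianNoise σε ε P)
    (hind : IndepFun (fun ω => fun (i : Fin N) (a : Fin n) => X ω i a) ε P) (hη : 0 ≤ η) :
    P.real {ω | ∃ a, N * η < |(ε ω ᵥ* X ω) a|}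
      ≤ n * Real.exp (-N) + n * (2 * Real.exp (-(N * η ^ 2) / (16 * (σ * σε) ^ 2))) := by
  let V : NNReal := .mk (N * (8 * σ ^ 2)) (by positivity)
  have column (a : Fin n) : P.real {ω | ∑ i, X ω i a ^ 2 ≤ V ∧ N * η < |(ε ω ᵥ* X ω) a|}
      ≤ 2 * Real.exp (-(N * η ^ 2) / (16 * (σ * σε) ^ 2)) := by
    have hcol : Measurable fun (z : Fin N → Fin n → ℝ) (i : Fin N) => z i a := by fun_prop
    have tail := measureReal_lt_abs_dotProduct_le (V := V)
      (measurable_pi_iff.2 fun i => hX.measurable i a) (measurable_pi_iff.2 hε.measurable)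
      (hind.comp hcol measurable_id) hε.indep (fun i => (hε.subGaussian i).hasSubgaussianMGF)
      (by positivity : 0 ≤ N * η)
    simp only [dotProduct_comm _ (ε _)] at tail
    refine tail.trans_eq ?_
    simp only [V, NNReal.coe_mk]
    congr 2
    field_simp
    ring
  have split : {ω | ∃ a, N * η < |(ε ω ᵥ* X ω) a|}
      ⊆ {ω | ∃ a, N * (8 * σ ^ 2) ≤ ∑ i, X ω i a ^ 2}
        ∪ ⋃ a, {ω | ∑ i, X ω i a ^ 2 ≤ V ∧ N * η < |(ε ω ᵥ* X ω) a|} := by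
    rintro ω ⟨a, ha⟩
    rcases le_total (N * (8 * σ ^ 2)) (∑ i, X ω i a ^ 2) with h | h
    · exact Or.inl ⟨a, h⟩
    · exact Or.inr (Set.mem_iUnion.2 ⟨a, h, ha⟩)
  refine (measureReal_mono split).trans ((measureReal_union_le _ _).trans (add_le_add
    (hX.measureReal_exists_column_le_exp hσ) ((measureReal_iUnion_fintype_le _).trans
      ((Finset.sum_le_sum fun a _ => column a).trans_eq ?_))))
  simp

end IsRowwiseSubGaussian

end Design

section ErrorBounds

/-- The number of atoms, per unit of sparsity, that the empirical method has to sample for designs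
with sub-Gaussian parameter `σ` and covariance bounded below by `c`: it makes the loss
`8 σ² * 64 / atomCount σ c` of the restricted eigenvalue at most `c / 4`. -/
def atomCount (σ c : ℝ) : ℕ := ⌈2048 * σ ^ 2 / c⌉₊

/-- The constant `C` of the sample size condition `C r log n ≤ N` under which a union bound over
`(3 n) ^ (atomCount σ c * r + 1)` signed sums is affordable. -/
def sampleSizeFactor (σ c : ℝ) : ℝ := 12 * atomCount σ c / (c ^ 2 / (384 * σ ^ 4)) + 2

/-- An upper bound for the probability that the design is degenerate. -/
def designTail (σ c : ℝ) (N : ℕ) : ℝ :=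
  Real.exp (-(N * (c ^ 2 / (384 * σ ^ 4)) / 2)) + 2 * Real.exp (-(N / 2))

/-- The order of magnitude `σ √(log n / N)` of the correlation of the noise with the columns of the
design, relative to `N`. -/
def noiseRate (σ : ℝ) (n N : ℕ) : ℝ := σ * √(Real.log n / N)

/-- A linear model with a row-wise sub-Gaussian design whose covariance matrix has no eigenvalue
below `c`, and with independent sub-Gaussian noise. -/
structure IsSubGaussianModel {Ω : Type*} [MeasurableSpace Ω] {N n : ℕ} (σ c σε : ℝ)
    (S : Matrix (Fin n) (Fin n) ℝ) (X : Ω → Matrix (Fin N) (Fin n) ℝ) (ε : Ω → Fin N → ℝ)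
    (P : Measure Ω) : Prop where
  design : IsRowwiseSubGaussian σ S X P
  spectrum_subset : spectrum ℝ S ⊆ Set.Ici c
  noise_pos : 0 < σε
  noise : IsSubGaussianNoise σε ε P
  indep : IndepFun (fun ω => fun (i : Fin N) (a : Fin n) => X ω i a) ε P

variable {N n r s : ℕ} {σ c σε : ℝ}

lemma atomCount_pos (hσ : 0 < σ) (hc : 0 < c) : 0 < atomCount σ c :=
  Nat.ceil_pos.2 (by positivity)

lemma sampleSizeFactor_pos (hσ : 0 < σ) (hc : 0 < c) : 0 < sampleSizeFactor σ c := by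
  rw [sampleSizeFactor]
  positivity

lemma log_natCast_pos (hn : 2 ≤ n) : 0 < Real.log n :=
  Real.log_pos (by exact_mod_cast hn)

lemma pos_of_sampleSizeFactor_le (hσ : 0 < σ) (hc : 0 < c) (hn : 2 ≤ n) (hr : 0 < r)
    (hN : sampleSizeFactor σ c * (r * Real.log n) ≤ N) : 0 < N := by
  have := log_natCast_pos hn
  have := sampleSizeFactor_pos hσ hc
  exact_mod_cast (by positivity : 0 < sampleSizeFactor σ c * (r * Real.log n)).trans_le hN

lemma noiseRate_pos (hσε : 0 < σε) (hn : 2 ≤ n) (hN : 0 < N) : 0 < noiseRate σε n N := by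
  have := log_natCast_pos hn
  rw [noiseRate]
  positivity

lemma tendsto_designTail (hσ : 0 < σ) (hc : 0 < c) :
    Tendsto (designTail σ c) atTop (𝓝 0) := by
  have decay {a : ℝ} (ha : 0 < a) : Tendsto (fun N : ℕ => Real.exp (-(N * a))) atTop (𝓝 0) :=
    Real.tendsto_exp_neg_atTop_nhds_zero.comp
      (tendsto_natCast_atTop_atTop.atTop_mul_const ha)
  have := (decay (a := c ^ 2 / (384 * σ ^ 4) / 2) (by positivity)).add
    ((decay (a := 1 / 2) (by positivity)).const_mul 2)
  rw [zero_add, mul_zero] at this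
  refine this.congr fun N => ?_
  rw [designTail, mul_div_assoc, mul_one_div]

lemma three_mul_pow_mul_exp_le {q : ℝ} {m : ℕ} (hn : 2 ≤ n) (hm : 0 < m)
    (hN : 12 * m * Real.log n ≤ N * q) :
    (3 * n : ℝ) ^ (m + 1) * Real.exp (-(N * q)) ≤ Real.exp (-(N * q / 2)) := by
  have hn' : (2 : ℝ) ≤ n := by exact_mod_cast hn
  have hlog := log_natCast_pos hn
  have hm' : (1 : ℝ) ≤ m := by exact_mod_cast hm
  have cube : 3 * (n : ℝ) ≤ Real.exp (3 * Real.log n) := by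
    rw [mul_comm _ (Real.log n), Real.exp_mul, Real.exp_log (by positivity),
      Real.rpow_ofNat]
    nlinarith [mul_nonneg (sq_nonneg (n : ℝ)) (sub_nonneg.2 hn')]
  calc (3 * n : ℝ) ^ (m + 1) * Real.exp (-(N * q))
      ≤ Real.exp (3 * Real.log n) ^ (m + 1) * Real.exp (-(N * q)) := by gcongr
    _ = Real.exp ((m + 1) * (3 * Real.log n) - N * q) := by
        rw [← Real.exp_nat_mul, ← Real.exp_add]
        push_cast
        rfl
    _ ≤ Real.exp (-(N * q / 2)) := by
        gcongr
        nlinarith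

lemma mul_exp_neg_le_exp_neg_half (hn : 2 ≤ n) (hN : 2 * Real.log n ≤ N) :
    n * Real.exp (-N) ≤ Real.exp (-(N / 2)) := by
  have hn' : (0 : ℝ) < n := by positivity
  calc n * Real.exp (-N) = Real.exp (Real.log n + -N) := by
        rw [Real.exp_add, Real.exp_log hn']
    _ ≤ Real.exp (-(N / 2)) := by
        gcongr
        linarith

lemma two_mul_log_le_of_sampleSizeFactor_le (hn : 2 ≤ n) (hr : 0 < r)
    (hN : sampleSizeFactor σ c * (r * Real.log n) ≤ N) : 2 * Real.log n ≤ N := by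
  have hr' : (1 : ℝ) ≤ r := by exact_mod_cast hr
  have hlog := log_natCast_pos hn
  have : 0 ≤ 12 * atomCount σ c / (c ^ 2 / (384 * σ ^ 4)) * (r * Real.log n) := by positivity
  have : Real.log n ≤ r * Real.log n := le_mul_of_one_le_left hlog.le hr'
  rw [sampleSizeFactor] at hN
  linarith

variable {Ω : Type*} [MeasurableSpace Ω] {P : Measure Ω} [IsProbabilityMeasure P]
  {S : Matrix (Fin n) (Fin n) ℝ} {X : Ω → Matrix (Fin N) (Fin n) ℝ} {ε : Ω → Fin N → ℝ}

lemma IsRowwiseSubGaussian.measureReal_not_hasRestrictedEigenvalue_le_exp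
    (hX : IsRowwiseSubGaussian σ S X P) (hσ : 0 < σ) (hc : 0 < c)
    (hspec : spectrum ℝ S ⊆ Set.Ici c) (hn : 2 ≤ n) (hr : 0 < r)
    (hN : sampleSizeFactor σ c * (r * Real.log n) ≤ N) :
    P.real {ω | ¬ HasRestrictedEigenvalue (X ω) (c / 4) (64 * r)}
      ≤ Real.exp (-(N * (c ^ 2 / (384 * σ ^ 4)) / 2)) + Real.exp (-(N / 2)) := by
  have hlog := log_natCast_pos hn
  have hK := atomCount_pos hσ hc
  set K := atomCount σ c
  set q := c ^ 2 / (384 * σ ^ 4)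
  have hq0 : 0 < q := by positivity
  have loss : c / 4 ≤ c / 2 - 8 * σ ^ 2 * (64 * r) / (K * r : ℕ) := by
    have hKc : 2048 * σ ^ 2 ≤ K * c := (div_le_iff₀ hc).1 (Nat.le_ceil _)
    have : 8 * σ ^ 2 * (64 * r) / (K * r : ℕ) ≤ c / 4 := by
      rw [div_le_iff₀ (by positivity)]
      push_cast
      nlinarith [mul_le_mul_of_nonneg_right hKc (Nat.cast_nonneg r : (0 : ℝ) ≤ r)]
    linarith
  have entropy : 12 * (K * r : ℕ) * Real.log n ≤ N * q := by
    have hN' : 12 * K / q * (r * Real.log n) ≤ N :=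
      hN.trans' (mul_le_mul_of_nonneg_right (le_add_of_nonneg_right zero_le_two) (by positivity))
    calc 12 * ((K * r : ℕ) : ℝ) * Real.log n = 12 * K / q * (r * Real.log n) * q := by
          push_cast
          field_simp
      _ ≤ N * q := by gcongr
  have tail := hX.measureReal_not_hasRestrictedEigenvalue_le hσ hc.le hspec
    (pos_of_sampleSizeFactor_le hσ hc hn hr hN) (Nat.mul_pos hK hr) (64 * r)
  refine le_trans (measureReal_mono ?_) (tail.trans ?_)
  · exact fun ω hω hRE => hω (hRE.mono loss le_rfl)
  · exact add_le_add (three_mul_pow_mul_exp_le hn (Nat.mul_pos hK hr) entropy)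
      (mul_exp_neg_le_exp_neg_half hn (two_mul_log_le_of_sampleSizeFactor_le hn hr hN))

namespace IsSubGaussianModel

lemma measureReal_exists_lt_abs_vecMul_le_exp (h : IsSubGaussianModel σ c σε S X ε P)
    (hσ : 0 < σ) (hn : 2 ≤ n) (hN : 2 * Real.log n ≤ N) {p : ℝ} (hp : 0 ≤ p) :
    P.real {ω | ∃ a, N * (4 * σ * √p * noiseRate σε n N) < |(ε ω ᵥ* X ω) a|}
      ≤ Real.exp (-(N / 2)) + 2 * n * Real.exp (-(p * Real.log n)) := by
  have hlog := log_natCast_pos hn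
  have hσε := h.noise_pos
  have hN' : (0 : ℝ) < N := by linarith
  have hη : 0 ≤ 4 * σ * √p * noiseRate σε n N := by
    rw [noiseRate]
    positivity
  have exponent : -(N * (4 * σ * √p * noiseRate σε n N) ^ 2) / (16 * (σ * σε) ^ 2)
      = -(p * Real.log n) := by
    rw [noiseRate, mul_pow _ (σε * _), mul_pow σε, mul_pow _ √p, Real.sq_sqrt hp,
      Real.sq_sqrt (by positivity)]
    field_simp
    ring
  have tail := h.design.measureReal_exists_lt_abs_vecMul_le hσ h.noise h.indep hη
  rw [exponent] at tail
  linarith [mul_exp_neg_le_exp_neg_half hn hN]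

lemma measureReal_degenerate_le (h : IsSubGaussianModel σ c σε S X ε P) (hσ : 0 < σ) (hc : 0 < c)
    (hn : 2 ≤ n) (hr : 0 < r) (hN : sampleSizeFactor σ c * (r * Real.log n) ≤ N) {p : ℝ}
    (hp : 0 ≤ p) :
    P.real {ω | ¬ (HasRestrictedEigenvalue (X ω) (c / 4) (64 * r)
        ∧ ∀ a, |(ε ω ᵥ* X ω) a| ≤ N * (4 * σ * √p * noiseRate σε n N))}
      ≤ designTail σ c N + 2 * n * Real.exp (-(p * Real.log n)) := by
  simp only [not_and_or, not_forall, not_le, Set.ofPred_or]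
  have hdesign := h.design.measureReal_not_hasRestrictedEigenvalue_le_exp hσ hc h.spectrum_subset
    hn hr hN
  have hnoise := h.measureReal_exists_lt_abs_vecMul_le_exp hσ hn
    (two_mul_log_le_of_sampleSizeFactor_le hn hr hN) hp
  rw [designTail]
  linarith [measureReal_union_le (μ := P) {ω | ¬ HasRestrictedEigenvalue (X ω) (c / 4) (64 * r)}
    {ω | ∃ a, N * (4 * σ * √p * noiseRate σε n N) < |(ε ω ᵥ* X ω) a|}]

variable {e : Ω → Fin n → ℝ} {lam c₁ : ℝ}

lemma measureReal_not_hasErrorBounds_le (h : IsSubGaussianModel σ c σε S X ε P) (hσ : 0 < σ)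
    (hc : 0 < c) (hn : 2 ≤ n) (hs : 0 < s) (hN : sampleSizeFactor σ c * (s * Real.log n) ≤ N)
    (hlam : 16 * σ * noiseRate σε n N ≤ lam) (hlam_le : lam ≤ c₁ * noiseRate σε n N)
    (hbasic : ∀ᵐ ω ∂P, SatisfiesBasicInequality (X ω) (ε ω) lam s (e ω)) :
    P.real {ω | ¬ HasErrorBounds (X ω) (noiseRate σε n N) s ((8 * max c₁ 1) ^ 2 / (c / 4)) (e ω)}
      ≤ designTail σ c N + 2 * n * Real.exp (-(4 * Real.log n)) := by
  have hτ := noiseRate_pos h.noise_pos hn (pos_of_sampleSizeFactor_le hσ hc hn hs hN)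
  have hsqrt : 4 * σ * √4 = 8 * σ := by
    rw [show (4 : ℝ) = 2 ^ 2 by norm_num, Real.sqrt_sq zero_le_two]
    ring
  refine le_trans (ENNReal.toReal_mono (measure_ne_top _ _) (measure_mono_ae ?_))
    (h.measureReal_degenerate_le hσ hc hn hs hN (p := 4) (by norm_num))
  filter_upwards [hbasic] with ω hω hbad hgood
  exact hbad (hω.hasErrorBounds_of_noise_le_half hgood.1 (by positivity)
    (by positivity) hgood.2 (lt_of_lt_of_le (by positivity) hlam) (by rw [hsqrt]; linarith)
    hτ.le hlam_le)

lemma measureReal_not_hasErrorBounds_le_of_card_le (h : IsSubGaussianModel σ c σε S X ε P)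
    (hσ : 0 < σ) (hc : 0 < c) (hn : 2 ≤ n) (hs : 0 < s) {n₀ : ℕ} (hn₀ : n ≤ n₀)
    (hN : sampleSizeFactor σ c * (n * Real.log n) ≤ N) {p : ℝ} (hp : 0 ≤ p) (hlam : 0 ≤ lam)
    (hlam_le : lam ≤ c₁ * noiseRate σε n N)
    (hbasic : ∀ᵐ ω ∂P, SatisfiesBasicInequality (X ω) (ε ω) lam s (e ω)) :
    P.real {ω | ¬ HasErrorBounds (X ω) (noiseRate σε n N) s
        ((8 * max c₁ 1 + (2 * (4 * σ * √p) + 1) * √n₀) ^ 2 / (c / 4)) (e ω)}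
      ≤ designTail σ c N + 2 * n * Real.exp (-(p * Real.log n)) := by
  have hn0 : 0 < n := by omega
  have hτ := noiseRate_pos h.noise_pos hn (pos_of_sampleSizeFactor_le hσ hc hn hn0 hN)
  refine le_trans (ENNReal.toReal_mono (measure_ne_top _ _) (measure_mono_ae ?_))
    (h.measureReal_degenerate_le hσ hc hn hn0 hN hp)
  filter_upwards [hbasic] with ω hω hbad hgood
  have hRE : HasRestrictedEigenvalue (X ω) (c / 4) n :=
    hgood.1.mono le_rfl (le_mul_of_one_le_left (Nat.cast_nonneg n) (by norm_num))
  exact hbad (hω.hasErrorBounds_of_card_le hRE (by positivity) (by positivity) hτ.le hgood.2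
    hlam hlam_le hs hn₀)

end IsSubGaussianModel

lemma two_mul_mul_exp_neg_four_mul_log_le {δ : ℝ} (hδ : 0 < δ) (hn : 4 / δ ≤ n) :
    2 * n * Real.exp (-(4 * Real.log n)) ≤ δ / 2 := by
  have hn0 : (0 : ℝ) < n := lt_of_lt_of_le (by positivity) hn
  have hn1 : (1 : ℝ) ≤ n := by exact_mod_cast hn0
  rw [div_le_iff₀ hδ] at hn
  have hexp : Real.exp (-(4 * Real.log n)) = ((n : ℝ) ^ 4)⁻¹ := by
    rw [Real.exp_neg, mul_comm _ (Real.log n), Real.exp_mul, Real.exp_log hn0,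
      Real.rpow_ofNat]
  calc 2 * n * Real.exp (-(4 * Real.log n)) = 2 / n ^ 3 := by
        rw [hexp]
        field_simp
    _ ≤ 2 / n := by
        gcongr
        exact le_self_pow₀ hn1 (by norm_num)
    _ ≤ δ / 2 := by
        rw [div_le_div_iff₀ hn0 two_pos]
        linarith

lemma two_mul_mul_exp_neg_mul_log_le {δ : ℝ} (hδ : 0 < δ) (hn : 2 ≤ n) {n₀ : ℕ} (hn₀ : n ≤ n₀) :
    2 * n * Real.exp (-(8 * n₀ / δ * Real.log n)) ≤ δ / 2 := by
  have hn₀0 : (0 : ℝ) < n₀ := by exact_mod_cast (by omega : 0 < n₀)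
  have hlog : 1 / 2 ≤ Real.log n := by
    have : Real.log 2 ≤ Real.log n := Real.log_le_log two_pos (by exact_mod_cast hn)
    linarith [Real.log_two_gt_d9]
  have hexp : 4 * n₀ / δ ≤ Real.exp (8 * n₀ / δ * Real.log n) := by
    calc 4 * n₀ / δ = 8 * n₀ / δ * (1 / 2) := by ring
      _ ≤ 8 * n₀ / δ * Real.log n := by gcongr
      _ ≤ Real.exp (8 * n₀ / δ * Real.log n) := by
          linarith [Real.add_one_le_exp (8 * n₀ / δ * Real.log n)]
  calc 2 * n * Real.exp (-(8 * n₀ / δ * Real.log n)) ≤ 2 * n₀ * (4 * n₀ / δ)⁻¹ := by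
        rw [Real.exp_neg]
        gcongr
    _ = δ / 2 := by
        field_simp
        norm_num

-- For `n ≥ 4 / δ` the penalty dominates the noise with probability `1 - O(1 / n)`. For the finitely
-- many smaller `n` it need not do so, and the restricted eigenvalue condition on the whole space
-- takes over.
lemma exists_measure_not_hasErrorBounds_le (hσ : 0 < σ) (hc : 0 < c) (c₁ : ℝ) {δ : ℝ}
    (hδ : 0 < δ) : ∃ M : ℝ, 0 < M ∧ ∃ N₀ : ℕ, ∀ {Ω : Type*} [MeasurableSpace Ω] {P : Measure Ω}
      [IsProbabilityMeasure P] {N n s : ℕ} {S : Matrix (Fin n) (Fin n) ℝ}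
      {X : Ω → Matrix (Fin N) (Fin n) ℝ} {ε : Ω → Fin N → ℝ} {e : Ω → Fin n → ℝ} {σε lam : ℝ},
      IsSubGaussianModel σ c σε S X ε P → N₀ ≤ N → 2 ≤ n → 0 < s →
      sampleSizeFactor σ c * (s * Real.log n) ≤ N → 16 * σ * noiseRate σε n N ≤ lam →
      lam ≤ c₁ * noiseRate σε n N →
      (∀ᵐ ω ∂P, SatisfiesBasicInequality (X ω) (ε ω) lam s (e ω)) →
      P {ω | ¬ HasErrorBounds (X ω) (noiseRate σε n N) s M (e ω)} ≤ ENNReal.ofReal δ := by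
  set n₀ := ⌈4 / δ⌉₊
  set p := 8 * n₀ / δ
  have hp : 0 ≤ p := by positivity
  have hC := sampleSizeFactor_pos hσ hc
  obtain ⟨N₁, hN₁⟩ := eventually_atTop.1
    ((tendsto_designTail hσ hc).eventually_le_const (half_pos hδ))
  refine ⟨(8 * max c₁ 1 + (2 * (4 * σ * √p) + 1) * √n₀) ^ 2 / (c / 4), by positivity,
    max N₁ ⌈sampleSizeFactor σ c * (n₀ * Real.log n₀)⌉₊, ?_⟩
  intro Ω _ P _ N n s S X ε e σε lam h hN₀ hn hs hN hlam hlam_le hbasic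
  have hdesign := hN₁ N ((le_max_left _ _).trans hN₀)
  have hτ := noiseRate_pos h.noise_pos hn (pos_of_sampleSizeFactor_le hσ hc hn hs hN)
  refine (ENNReal.le_ofReal_iff_toReal_le (measure_ne_top _ _) hδ.le).2 ?_
  rcases le_total n n₀ with hn₀ | hn₀
  · have hN' : sampleSizeFactor σ c * (n * Real.log n) ≤ N := by
      calc sampleSizeFactor σ c * (n * Real.log n)
          ≤ sampleSizeFactor σ c * (n₀ * Real.log n₀) := by gcongr
        _ ≤ N := Nat.ceil_le.1 ((le_max_right _ _).trans hN₀)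
    have := h.measureReal_not_hasErrorBounds_le_of_card_le hσ hc hn hs hn₀ hN' hp
      (hlam.trans' (by positivity)) hlam_le hbasic
    exact this.trans (by linarith [two_mul_mul_exp_neg_mul_log_le hδ hn hn₀])
  · have := h.measureReal_not_hasErrorBounds_le hσ hc hn hs hN hlam hlam_le hbasic
    have hM : (8 * max c₁ 1) ^ 2 / (c / 4)
        ≤ (8 * max c₁ 1 + (2 * (4 * σ * √p) + 1) * √n₀) ^ 2 / (c / 4) := by
      gcongr
      exact le_add_of_nonneg_right (by positivity)
    refine le_trans (measureReal_mono ?_) (this.trans ?_)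
    · exact fun ω hω hb => hω (hb.mono hτ.le hM)
    · linarith [two_mul_mul_exp_neg_four_mul_log_le hδ (Nat.ceil_le.1 hn₀)]

end ErrorBounds

section Theorem

lemma IsBigOP.of_forall_abs_le {Ω : ℕ → Type*} [∀ j, MeasurableSpace (Ω j)]
    {P : ∀ j, Measure (Ω j)} {Y : ∀ j, Ω j → ℝ} {a : ℕ → ℝ} {Good : ℝ → ∀ j, Ω j → Prop}
    (hGood : ∀ δ : ℝ, 0 < δ → ∃ M : ℝ, 0 < M ∧
      ∀ᶠ j in atTop, P j {ω | ¬ Good M j ω} ≤ ENNReal.ofReal δ)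
    (hle : ∀ M j ω, Good M j ω → |Y j ω| ≤ M * a j) : IsBigOP P Y a := by
  intro δ hδ
  obtain ⟨M, hM, hev⟩ := hGood δ hδ
  refine ⟨M, hM, hev.mono fun j hj => (measure_mono ?_).trans hj⟩
  exact fun ω hω hgood => (hle M j ω hgood).not_gt hω

lemma noiseRate_mul_sqrt (σ : ℝ) (n N s : ℕ) :
    noiseRate σ n N * √s = σ * √(s * Real.log n / N) := by
  rw [noiseRate, mul_assoc, mul_comm √_, mul_div_assoc, Real.sqrt_mul (Nat.cast_nonneg s)]

lemma noiseRate_mul (σ : ℝ) (n N s : ℕ) :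
    noiseRate σ n N * s = σ * s * √(Real.log n / N) := by
  rw [noiseRate, mul_right_comm]

lemma noiseRate_sq_mul (σ : ℝ) (n N s : ℕ) :
    noiseRate σ n N ^ 2 * s = σ ^ 2 * (s * Real.log n / N) := by
  rw [noiseRate, mul_pow, Real.sq_sqrt (div_nonneg (Real.log_natCast_nonneg n) (Nat.cast_nonneg N))]
  ring

end Theorem

end GraphLasso

end

open GraphLasso in
theorem theorem2_general (σx cmin : ℝ) (hσx : 0 < σx) (hcmin : 0 < cmin) :
    ∃ c₀ C₀ : ℝ, 0 < c₀ ∧ 0 < C₀ ∧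
    ∀ (c₁ : ℝ)
      (k N n s₁ s₂ : ℕ → ℕ)
      (σε lam lamg : ℕ → ℝ)
      (G : ∀ j, SimpleGraph (Fin (n j)))
      (Ω : ℕ → Type*) [∀ j, MeasurableSpace (Ω j)]
      (P : ∀ j, Measure (Ω j)) [∀ j, IsProbabilityMeasure (P j)]
      (S : ∀ j, Matrix (Fin (n j)) (Fin (n j)) ℝ)
      (X : ∀ j, Ω j → Matrix (Fin (N j)) (Fin (n j)) ℝ)
      (ε : ∀ j, Ω j → Fin (N j) → ℝ)
      (βstar : ∀ j, Fin (n j) → ℝ)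
      (βhat : ∀ j, Ω j → Fin (n j) → ℝ),
      Tendsto N atTop atTop →
      (∀ j, 2 ≤ n j) →
      (∀ j, C₀ * (s₂ j * Real.log (n j)) ≤ N j) →
      (∀ j, 0 < s₂ j) →
      (∀ j, βstar j ∈ sparseClass (G j) (k j) (s₁ j) (s₂ j)) →
      (∀ j, IsRowwiseSubGaussian σx (S j) (X j) (P j)) →
      (∀ j, spectrum ℝ (S j) ⊆ Set.Ici cmin) →
      (∀ j, 0 < σε j) →
      (∀ j, IsSubGaussianNoise (σε j) (ε j) (P j)) →
      (∀ j, IndepFun (fun ω => fun (i : Fin (N j)) (a : Fin (n j)) => X j ω i a) (ε j) (P j)) →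
      (∀ j, c₀ * (σε j * √(Real.log (n j) / N j)) ≤ lam j) →
      (∀ j, lam j ≤ c₁ * (σε j * √(Real.log (n j) / N j))) →
      (∀ j, 0 ≤ lamg j) →
      (∀ j, lamg j ^ 2 * ((2 * maxDeg (G j)) ^ (k j + 1) * s₁ j) ≤ lam j ^ 2 * s₂ j) →
      (∀ j, ∀ᵐ ω ∂(P j), IsEstimate (G j) (k j) (X j ω) (X j ω *ᵥ βstar j + ε j ω)
        (lamg j) (lam j) (βhat j ω)) →
      IsBigOP P (fun j ω => l2Norm (βhat j ω - βstar j))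
        (fun j => σε j * √(s₂ j * Real.log (n j) / N j)) ∧
      IsBigOP P (fun j ω => l1Norm (βhat j ω - βstar j))
        (fun j => σε j * s₂ j * √(Real.log (n j) / N j)) ∧
      IsBigOP P (fun j ω => 1 / (N j : ℝ) * l2Norm (X j ω *ᵥ (βhat j ω - βstar j)) ^ 2)
        (fun j => σε j ^ 2 * (s₂ j * Real.log (n j) / N j)) := by
  refine ⟨16 * σx, sampleSizeFactor σx cmin, by positivity, sampleSizeFactor_pos hσx hcmin, ?_⟩
  intro c₁ k N n s₁ s₂ σε lam lamg G Ω _ P _ S X ε βstar βhat hN hn hsize hs₂ hβ hX hspec hσε hε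
    hindep hlam hlam_le hlamg htuning hmin
  have basic (j : ℕ) : ∀ᵐ ω ∂(P j),
      SatisfiesBasicInequality (X j ω) (ε j ω) (lam j) (s₂ j) (βhat j ω - βstar j) := by
    have hlam0 : 0 ≤ lam j := (hlam j).trans' (by have := hσε j; positivity)
    filter_upwards [hmin j] with ω hω
    exact hω.satisfiesBasicInequality hlam0 (hlamg j) (htuning j) (hβ j)
  have bounds (δ : ℝ) (hδ : 0 < δ) : ∃ M : ℝ, 0 < M ∧ ∀ᶠ j in atTop,
      P j {ω | ¬ HasErrorBounds (X j ω) (noiseRate (σε j) (n j) (N j)) (s₂ j) M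
        (βhat j ω - βstar j)} ≤ ENNReal.ofReal δ := by
    obtain ⟨M, hM, N₀, hN₀⟩ := exists_measure_not_hasErrorBounds_le hσx hcmin c₁ hδ
    refine ⟨M, hM, (hN.eventually_ge_atTop N₀).mono fun j hj => ?_⟩
    exact hN₀ ⟨hX j, hspec j, hσε j, hε j, hindep j⟩ hj (hn j) (hs₂ j) (hsize j) (hlam j)
      (hlam_le j) (basic j)
  refine ⟨.of_forall_abs_le bounds fun M j ω h => ?_, .of_forall_abs_le bounds fun M j ω h => ?_,
    .of_forall_abs_le bounds fun M j ω h => ?_⟩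
  · rw [← noiseRate_mul_sqrt, abs_of_nonneg (l2Norm_nonneg _)]
    exact h.l2Norm_le
  · rw [← noiseRate_mul, abs_of_nonneg (l1Norm_nonneg _)]
    exact h.l1Norm_le
  · rw [← noiseRate_sq_mul, abs_of_nonneg (by positivity)]
    exact h.prediction_le

theorem theorem2
    (k : ℕ) (σx cmin cmax ν : ℝ) (hσx : 0 < σx) (hcmin : 0 < cmin) (hcmax : 0 < cmax)
    (hν0 : 0 ≤ ν) (hν1 : ν < 1) :
    ∃ c₀ C₀ : ℝ, 0 < c₀ ∧ 0 < C₀ ∧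
    ∀ (c₁ : ℝ)
      (N n s₁ s₂ : ℕ → ℕ)
      (σε lam lamg : ℕ → ℝ)
      (G : ∀ j, SimpleGraph (Fin (n j)))
      (Ω : ℕ → Type*) [∀ j, MeasurableSpace (Ω j)]
      (P : ∀ j, Measure (Ω j)) [∀ j, IsProbabilityMeasure (P j)]
      (S : ∀ j, Matrix (Fin (n j)) (Fin (n j)) ℝ)
      (X : ∀ j, Ω j → Matrix (Fin (N j)) (Fin (n j)) ℝ)
      (ε : ∀ j, Ω j → Fin (N j) → ℝ)
      (βstar : ∀ j, Fin (n j) → ℝ)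
      (βhat : ∀ j, Ω j → Fin (n j) → ℝ),
      -- dimensions and sample size
      Tendsto N atTop atTop →
      (∀ j, 2 ≤ n j) →
      (∀ j, C₀ * ((s₂ j : ℝ) * Real.log (n j)) ≤ (N j : ℝ)) →
      -- the regression vector
      (∀ j, 0 < s₁ j) →
      (∀ j, 0 < s₂ j) →
      (∀ j, ν ≤ (s₂ j : ℝ) / (s₁ j : ℝ)) →
      (∀ j, βstar j ∈ GraphLasso.sparseClass (G j) k (s₁ j) (s₂ j)) →
      -- the random design
      (∀ j, GraphLasso.IsRowwiseSubGaussian σx (S j) (X j) (P j)) →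
      (∀ j, spectrum ℝ (S j) ⊆ Set.Icc cmin cmax) →
      -- the noise
      (∀ j, 0 < σε j) →
      (∀ j, GraphLasso.IsSubGaussianNoise (σε j) (ε j) (P j)) →
      (∀ j, IndepFun (fun ω => fun (i : Fin (N j)) (a : Fin (n j)) => X j ω i a) (ε j) (P j)) →
      -- the tuning parameters
      (∀ j, c₀ * (σε j * Real.sqrt (Real.log (n j) / (N j : ℝ))) ≤ lam j) →
      (∀ j, lam j ≤ c₁ * (σε j * Real.sqrt (Real.log (n j) / (N j : ℝ)))) →
      (∀ j, lamg j =
        lam j * Real.sqrt (ν / (2 * (GraphLasso.maxDeg (G j) : ℝ)) ^ (k + 1))) →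
      -- the estimator, computed from `X` and `y = X β* + ε`
      (∀ j, ∀ᵐ ω ∂(P j), GraphLasso.IsEstimate (G j) k (X j ω) (X j ω *ᵥ βstar j + ε j ω)
        (lamg j) (lam j) (βhat j ω)) →
      GraphLasso.IsBigOP P (fun j ω => GraphLasso.l2Norm (βhat j ω - βstar j))
        (fun j => σε j * Real.sqrt ((s₂ j : ℝ) * Real.log (n j) / (N j : ℝ))) ∧
      GraphLasso.IsBigOP P (fun j ω => GraphLasso.l1Norm (βhat j ω - βstar j))
        (fun j => σε j * (s₂ j : ℝ) * Real.sqrt (Real.log (n j) / (N j : ℝ))) ∧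
      GraphLasso.IsBigOP P
        (fun j ω =>
          1 / (N j : ℝ) * GraphLasso.l2Norm (X j ω *ᵥ (βhat j ω - βstar j)) ^ 2)
        (fun j => σε j ^ 2 * ((s₂ j : ℝ) * Real.log (n j) / (N j : ℝ))) := by
  obtain ⟨c₀, C₀, hc₀, hC₀, h⟩ := theorem2_general σx cmin hσx hcmin
  refine ⟨c₀, C₀, hc₀, hC₀, ?_⟩
  intro c₁ N n s₁ s₂ σε lam lamg G Ω _ P _ S X ε βstar βhat hN hn hsize _ hs₂ hν hβ hX hspec hσε
    hε hindep hlam hlam_le hlamg hmin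
  have hlam0 (j : ℕ) : 0 ≤ lam j := (hlam j).trans' (by have := hσε j; positivity)
  refine h c₁ (fun _ => k) N n s₁ s₂ σε lam lamg G Ω P S X ε βstar βhat hN hn hsize hs₂ hβ hX
    (fun j => (hspec j).trans Set.Icc_subset_Ici_self) hσε hε hindep hlam hlam_le ?_ ?_ hmin
  · exact fun j => (hlamg j).symm ▸ mul_nonneg (hlam0 j) (Real.sqrt_nonneg _)
  · exact fun j => (hlamg j).symm ▸ GraphLasso.tuning_sq_mul_le (by positivity) hν0
      (Nat.cast_nonneg _) (Nat.cast_nonneg _) (hν j)
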